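/- All manifolds are smooth, finite-dimensional, Hausdorff and second countable, without boundary. A filtered bundle of degree $k$ over $M$ is a smooth bundle $\mathcal F\to M$ with typical fibre $\mathbb R^{d_1}\times\dots\times\mathbb R^{d_k}$ and an atlas of local trivializations such that, when the coordinates of $\mathbb R^{d_w}$ are given weight $w$, every fibre coordinate of weight $w$ in one trivialization is a polynomial of weighted degree $\le w$ in the fibre coordinates of any other, with coefficients smooth functions on the base. Isomorphisms of filtered bundles over $M$ are diffeomorphisms over $\mathrm{id}_M$ that, together with their inverses, have this form in the trivializations. Forgetting the coordinates of weight $>i$ gives bundles $\mathcal F_{\{i\}}\to M$ and a tower of affine bundles $\mathcal F_{\{k\}}\to\dots\to\mathcal F_{\{1\}}\to\mathcal F_{\{0\}}=M$. An affine tower of height $k$ is a sequence of affine bundles $\tau_i:B_i\to B_{i-1}$ ($1\le i\le k$); put $M=B_0$, let $\tau^i_0:B_i\to M$ be the composed projection and $\mathsf v(B_i)\to B_{i-1}$ the model vector bundle of $\tau_i$. An isomorphism of affine towers over $M$ consists of diffeomorphisms of all levels, the identity on $M$, that commute with the projections and are affine on the fibres of the $\tau_i$. The tower is filterable if it is isomorphic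 over $M$ to the tower of a filtered bundle of degree $k$ over $M$. Theorem. Let $B_k\to\dots\to B_1\to B_0=M$ be a filterable affine tower. (1) Any two filtered bundles of degree $k$ over $M$ whose towers are isomorphic over $M$ to the given tower are isomorphic as filtered bundles over $M$. (2) There are vector bundles $V_1,\dots,V_k$ over $M$ such that $\mathsf v(B_i)\cong(\tau^{i-1}_0)^*V_i$ as vector bundles over $B_{i-1}$ for $i=1,\dots,k$. (3) For any vector bundles $V_1,\dots,V_k$ over $M$ as in (2), every filtered bundle of degree $k$ over $M$ whose tower is isomorphic over $M$ to the given tower is isomorphic, as a filtered bundle over $M$, to $V_1\oplus_M\dots\oplus_M V_k$, where the linear fibre coordinates of $V_i$ have weight $i$. (4) If $V_1,\dots,V_k$ and $W_1,\dots,W_k$ are both as in (2), then $V_i\cong W_i$ over $M$ for every $i$. -/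

import Mathlib

open Set Function Bundle
open scoped Manifold ContDiff Topology

universe u v w

noncomputable section

/-! ### Smooth manifolds -/

/-- A finite-dimensional smooth manifold: Hausdorff, second countable, without boundary. -/
structure SmoothManifold : Type (u + 1) where
  carrier : Type u
  E : Type u
  [normedAddCommGroup : NormedAddCommGroup E]
  [normedSpace : NormedSpace ℝ E]
  [finiteDimensional : FiniteDimensional ℝ E]
  H : Type u
  [topologicalSpaceModel : TopologicalSpace H]
  I : ModelWithCorners ℝ E H
  [boundaryless : I.Boundaryless]
  [topologicalSpace : TopologicalSpace carrier]
  [chartedSpace : ChartedSpace H carrier]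
  [isManifold : IsManifold I ∞ carrier]
  [t2Space : T2Space carrier]
  [secondCountable : SecondCountableTopology carrier]

instance : CoeSort SmoothManifold.{u} (Type u) := ⟨SmoothManifold.carrier⟩

attribute [instance] SmoothManifold.normedAddCommGroup SmoothManifold.normedSpace
  SmoothManifold.finiteDimensional SmoothManifold.topologicalSpaceModel
  SmoothManifold.boundaryless SmoothManifold.topologicalSpace SmoothManifold.chartedSpace
  SmoothManifold.isManifold SmoothManifold.t2Space SmoothManifold.secondCountable

/-- A local trivialization `pr⁻¹(U) ≃ U × F` which is a diffeomorphism. -/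
def IsSmoothTrivialization {P N : SmoothManifold.{u}} {F : Type*} [NormedAddCommGroup F]
    [NormedSpace ℝ F] {pr : P → N} (e : Trivialization F pr) : Prop :=
  ContMDiffOn P.I (N.I.prod 𝓘(ℝ, F)) ∞ e e.source ∧
    ContMDiffOn (N.I.prod 𝓘(ℝ, F)) P.I ∞ e.toOpenPartialHomeomorph.symm e.target

theorem contMDiff_of_smoothTrivializations {P N : SmoothManifold.{u}} {F : Type*}
    [NormedAddCommGroup F] [NormedSpace ℝ F] {pr : P → N}
    (h : ∀ x, ∃ e : Trivialization F pr, IsSmoothTrivialization e ∧ x ∈ e.baseSet) :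
    ContMDiff P.I N.I ∞ pr := by
  intro p
  obtain ⟨e, he, hx⟩ := h (pr p)
  have hp : p ∈ e.source := e.mem_source.2 hx
  have h1 : ContMDiffAt P.I (N.I.prod 𝓘(ℝ, F)) ∞ e p :=
    (he.1 p hp).contMDiffAt (e.open_source.mem_nhds hp)
  refine (contMDiffAt_fst.comp p h1).congr_of_eventuallyEq ?_
  filter_upwards [e.open_source.mem_nhds hp] with q hq
  exact (e.coe_fst hq).symm

theorem IsSmoothTrivialization.contMDiffOn_coordChange {P N : SmoothManifold.{u}} {F : Type*}
    [NormedAddCommGroup F] [NormedSpace ℝ F] {pr : P → N} {e e' : Trivialization F pr}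
    (he : IsSmoothTrivialization e) (he' : IsSmoothTrivialization e') :
    ContMDiffOn (N.I.prod 𝓘(ℝ, F)) 𝓘(ℝ, F) ∞ (fun p : N × F => e.coordChange e' p.1 p.2)
      ((e.baseSet ∩ e'.baseSet) ×ˢ univ) := by
  refine contMDiff_snd.comp_contMDiffOn (he'.1.comp (he.2.mono ?_) ?_)
  · rintro ⟨x, v⟩ hx
    exact e.mem_target.2 hx.1.1
  · rintro ⟨x, v⟩ hx
    have := e.proj_symm_apply' (x := v) hx.1.1
    exact e'.mem_source.2 (by rw [this]; exact hx.1.2)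

/-! ### Smooth bundles glued from transition functions -/

section Core

variable {M : SmoothManifold.{u}} {ι : Type*} {F : Type} [NormedAddCommGroup F]
  [NormedSpace ℝ F]

/-- The transition functions of a topological fibre bundle core are smooth. -/
def IsSmoothCore (Z : FiberBundleCore ι M F) : Prop :=
  ∀ i j, ContMDiffOn (M.I.prod 𝓘(ℝ, F)) 𝓘(ℝ, F) ∞
    (fun p : M × F => Z.coordChange i j p.1 p.2) ((Z.baseSet i ∩ Z.baseSet j) ×ˢ univ)

/-- The pregroupoid of smooth local maps of a product `M × F`. -/
def smoothPregroupoid (M : SmoothManifold.{u}) (F : Type) [NormedAddCommGroup F]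
    [NormedSpace ℝ F] : Pregroupoid (M × F) where
  property f s := ContMDiffOn (M.I.prod 𝓘(ℝ, F)) (M.I.prod 𝓘(ℝ, F)) ∞ f s
  comp hf hg _ _ _ := hg.comp (hf.mono inter_subset_left) (fun _ hx => hx.2)
  id_mem := contMDiffOn_id
  locality _ h := contMDiffOn_of_locally_contMDiffOn h
  congr _ h hf := hf.congr h

theorem IsSmoothCore.hasGroupoid {Z : FiberBundleCore ι M F} (hZ : IsSmoothCore Z) :
    HasGroupoid (TotalSpace F Z.Fiber) (smoothPregroupoid M F).groupoid := by
  apply hasGroupoid_of_pregroupoid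
  rintro _ _ ⟨_, ⟨i, rfl⟩, rfl⟩ ⟨_, ⟨j, rfl⟩, rfl⟩
  have hs : ((Z.localTriv i).toOpenPartialHomeomorph.symm ≫ₕ
      (Z.localTriv j).toOpenPartialHomeomorph).source
      = (Z.baseSet i ∩ Z.baseSet j) ×ˢ univ :=
    (Z.localTriv i).symm_trans_source_eq (Z.localTriv j)
  change ContMDiffOn (M.I.prod 𝓘(ℝ, F)) (M.I.prod 𝓘(ℝ, F)) ∞ _ _
  rw [hs]
  refine (contMDiffOn_fst.prodMk (hZ i j)).congr ?_
  rintro ⟨x, v⟩ hx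
  refine Prod.ext rfl ?_
  change Z.coordChange (Z.indexAt x) j x (Z.coordChange i (Z.indexAt x) x v) = _
  exact Z.coordChange_comp _ _ _ x ⟨⟨hx.1.1, Z.mem_baseSet_at x⟩, hx.1.2⟩ v

theorem IsSmoothCore.isManifold {Z : FiberBundleCore ι M F} (hZ : IsSmoothCore Z) :
    IsManifold (M.I.prod 𝓘(ℝ, F)) ∞ (TotalSpace F Z.Fiber) := by
  have := hZ.hasGroupoid
  refine { StructureGroupoid.HasGroupoid.comp (smoothPregroupoid M F).groupoid ?_ with }
  intro e he
  rw [isLocalStructomorphOn_contDiffGroupoid_iff]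
  exact mem_groupoid_of_pregroupoid.1 he

theorem coreTotal_t2Space (Z : FiberBundleCore ι M F) :
    T2Space (TotalSpace F Z.Fiber) := by
  refine ⟨fun p q hpq => ?_⟩
  by_cases h : p.proj = q.proj
  · let e := Z.localTrivAt p.proj
    have hp : p ∈ e.source := e.mem_source.2 (Z.mem_baseSet_at _)
    have hq : q ∈ e.source := e.mem_source.2 (by rw [← h]; exact Z.mem_baseSet_at _)
    have hne : e p ≠ e q := fun h' => hpq (e.injOn hp hq h')
    obtain ⟨U, V, hU, hV, hpU, hqV, hd⟩ := t2_separation hne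
    refine ⟨e.source ∩ e ⁻¹' U, e.source ∩ e ⁻¹' V,
      e.toOpenPartialHomeomorph.isOpen_inter_preimage hU,
      e.toOpenPartialHomeomorph.isOpen_inter_preimage hV, ⟨hp, hpU⟩, ⟨hq, hqV⟩, ?_⟩
    rw [Set.disjoint_left]
    rintro x ⟨_, hx⟩ ⟨_, hx'⟩
    exact Set.disjoint_left.1 hd hx hx'
  · obtain ⟨U, V, hU, hV, hpU, hqV, hd⟩ := t2_separation h
    exact ⟨_, _, hU.preimage (FiberBundle.continuous_proj F Z.Fiber),
      hV.preimage (FiberBundle.continuous_proj F Z.Fiber), hpU, hqV, hd.preimage _⟩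

theorem coreTotal_secondCountable [FiniteDimensional ℝ F] (Z : FiberBundleCore ι M F) :
    SecondCountableTopology (TotalSpace F Z.Fiber) := by
  obtain ⟨s, hs, hU⟩ := TopologicalSpace.countable_cover_nhds
    (f := fun x => Z.baseSet (Z.indexAt x))
    (fun x => (Z.isOpen_baseSet _).mem_nhds (Z.mem_baseSet_at x))
  have : Countable s := hs
  have (x : s) : SecondCountableTopology ((Z.localTrivAt x.1).source) :=
    (Z.localTrivAt x.1).toOpenPartialHomeomorph.secondCountableTopology_source
  refine TopologicalSpace.secondCountableTopology_of_countable_cover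
    (fun x : s => (Z.localTrivAt x.1).open_source) ?_
  rw [eq_univ_iff_forall] at hU ⊢
  intro p
  obtain ⟨x, hx, hpx⟩ := mem_iUnion₂.1 (hU p.proj)
  exact mem_iUnion.2 ⟨⟨x, hx⟩, (Z.localTrivAt x).mem_source.2 hpx⟩

/-- The total space of a smooth fibre bundle glued from its transition functions. -/
def coreManifold [FiniteDimensional ℝ F] (Z : FiberBundleCore ι M F) (hZ : IsSmoothCore Z) :
    SmoothManifold.{u} where
  carrier := TotalSpace F Z.Fiber
  E := M.E × F
  H := ModelProd M.H F
  I := M.I.prod 𝓘(ℝ, F)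
  isManifold := hZ.isManifold
  t2Space := coreTotal_t2Space Z
  secondCountable := coreTotal_secondCountable Z

theorem contMDiffAt_localTrivAt (Z : FiberBundleCore ι M F) (p : TotalSpace F Z.Fiber) :
    ContMDiffAt (M.I.prod 𝓘(ℝ, F)) (M.I.prod 𝓘(ℝ, F)) ∞ (Z.localTrivAt p.proj) p := by
  have h : ContMDiffAt (M.I.prod 𝓘(ℝ, F)) (M.I.prod 𝓘(ℝ, F)) ∞
    (id : TotalSpace F Z.Fiber → TotalSpace F Z.Fiber) p := contMDiffAt_id
  rw [contMDiffAt_totalSpace] at h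
  exact h.1.prodMk h.2

theorem contMDiffOn_localTriv (Z : FiberBundleCore ι M F) (hZ : IsSmoothCore Z) (i : ι) :
    ContMDiffOn (M.I.prod 𝓘(ℝ, F)) (M.I.prod 𝓘(ℝ, F)) ∞ (Z.localTriv i)
      (Z.localTriv i).source := by
  intro p hp
  have hi : p.proj ∈ Z.baseSet i := hp
  have hn : (Z.baseSet (Z.indexAt p.proj) ∩ Z.baseSet i) ×ˢ (univ : Set F) ∈
      𝓝 (Z.localTrivAt p.proj p) := by
    refine (((Z.isOpen_baseSet _).inter (Z.isOpen_baseSet _)).prod isOpen_univ).mem_nhds ?_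
    exact ⟨⟨Z.mem_baseSet_at _, hi⟩, mem_univ _⟩
  have h1 := (hZ (Z.indexAt p.proj) i).contMDiffAt hn
  have h2 := h1.comp p (contMDiffAt_localTrivAt Z p)
  have h3 : ContMDiffAt (M.I.prod 𝓘(ℝ, F)) M.I ∞ (TotalSpace.proj : TotalSpace F Z.Fiber → M) p :=
    contMDiffAt_proj Z.Fiber
  refine ((h3.prodMk h2).congr_of_eventuallyEq ?_).contMDiffWithinAt
  filter_upwards [(Z.localTriv i).open_source.mem_nhds hp,
    (Z.localTrivAt p.proj).open_source.mem_nhds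
      ((Z.localTrivAt p.proj).mem_source.2 (Z.mem_baseSet_at _))] with q hq hq'
  refine Prod.ext rfl ?_
  exact (Z.coordChange_comp _ _ _ q.proj ⟨⟨Z.mem_baseSet_at _, hq'⟩, hq⟩ q.2).symm

theorem contMDiffOn_localTriv_symm (Z : FiberBundleCore ι M F) (hZ : IsSmoothCore Z) (i : ι) :
    ContMDiffOn (M.I.prod 𝓘(ℝ, F)) (M.I.prod 𝓘(ℝ, F)) ∞
      (Z.localTriv i).toOpenPartialHomeomorph.symm (Z.localTriv i).target := by
  rintro ⟨x, v⟩ hx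
  have hi : x ∈ Z.baseSet i := hx.1
  have hn : (Z.baseSet i ∩ Z.baseSet (Z.indexAt x)) ×ˢ (univ : Set F) ∈ 𝓝 (x, v) := by
    refine (((Z.isOpen_baseSet _).inter (Z.isOpen_baseSet _)).prod isOpen_univ).mem_nhds ?_
    exact ⟨⟨hi, Z.mem_baseSet_at _⟩, mem_univ _⟩
  refine ContMDiffAt.contMDiffWithinAt ?_
  rw [contMDiffAt_totalSpace]
  refine ⟨contMDiffAt_fst, ?_⟩
  refine ((hZ i (Z.indexAt x)).contMDiffAt hn).congr_of_eventuallyEq ?_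
  filter_upwards [hn] with q hq
  exact Z.coordChange_comp i (Z.indexAt q.1) (Z.indexAt x) q.1
    ⟨⟨hq.1.1, Z.mem_baseSet_at _⟩, hq.1.2⟩ q.2

theorem isSmoothTrivialization_localTriv [FiniteDimensional ℝ F] (Z : FiberBundleCore ι M F)
    (hZ : IsSmoothCore Z) (i : ι) : IsSmoothTrivialization (P := coreManifold Z hZ) (N := M) (Z.localTriv i) :=
  ⟨contMDiffOn_localTriv Z hZ i, contMDiffOn_localTriv_symm Z hZ i⟩

end Core

/-! ### Smooth vector bundles -/

/-- A smooth real vector bundle of finite rank over a smooth manifold. -/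
structure SmoothVectorBundle (M : SmoothManifold.{u}) : Type (max u (v + 1)) where
  rank : ℕ
  fiber : M → Type v
  [addCommGroup : ∀ x, AddCommGroup (fiber x)]
  [module : ∀ x, Module ℝ (fiber x)]
  [topologicalSpaceFiber : ∀ x, TopologicalSpace (fiber x)]
  [topologicalSpaceTotal : TopologicalSpace (TotalSpace (Fin rank → ℝ) fiber)]
  [fiberBundle : FiberBundle (Fin rank → ℝ) fiber]
  [vectorBundle : VectorBundle ℝ (Fin rank → ℝ) fiber]
  [contMDiffVectorBundle : ContMDiffVectorBundle ∞ (Fin rank → ℝ) fiber M.I]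

namespace SmoothVectorBundle

attribute [instance] addCommGroup module topologicalSpaceFiber topologicalSpaceTotal fiberBundle
  vectorBundle contMDiffVectorBundle

variable {M N : SmoothManifold.{u}}

/-- The total space of a vector bundle. -/
abbrev Total (V : SmoothVectorBundle.{u, v} M) : Type (max u v) :=
  TotalSpace (Fin V.rank → ℝ) V.fiber

/-- An isomorphism of vector bundles over the identity of the base: a family of linear
isomorphisms of the fibres that is smooth, with smooth inverse, on the total spaces. -/
structure Iso (V : SmoothVectorBundle.{u, v} M) (W : SmoothVectorBundle.{u, w} M) where
  toLinearEquiv : ∀ x, V.fiber x ≃ₗ[ℝ] W.fiber x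
  contMDiff : ContMDiff (M.I.prod 𝓘(ℝ, Fin V.rank → ℝ)) (M.I.prod 𝓘(ℝ, Fin W.rank → ℝ)) ∞
    (fun p : V.Total => (⟨p.proj, toLinearEquiv p.proj p.snd⟩ : W.Total))
  contMDiff_symm : ContMDiff (M.I.prod 𝓘(ℝ, Fin W.rank → ℝ)) (M.I.prod 𝓘(ℝ, Fin V.rank → ℝ)) ∞
    (fun p : W.Total => (⟨p.proj, (toLinearEquiv p.proj).symm p.snd⟩ : V.Total))

/-- The pull-back `f^* V` of a vector bundle along a smooth map. -/
def pullback (V : SmoothVectorBundle.{u, v} M) (f : C^∞⟮N.I, N; M.I, M⟯) :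
    SmoothVectorBundle.{u, v} N where
  rank := V.rank
  fiber := f *ᵖ V.fiber
  addCommGroup x := V.addCommGroup (f x)
  module x := V.module (f x)
  vectorBundle := inferInstanceAs (VectorBundle ℝ (Fin V.rank → ℝ) ((f : N → M) *ᵖ V.fiber))
  contMDiffVectorBundle :=
    inferInstanceAs (ContMDiffVectorBundle ∞ (Fin V.rank → ℝ) ((f : N → M) *ᵖ V.fiber) N.I)

end SmoothVectorBundle

/-! ### Affine bundles and their model vector bundles -/

/-- An affine bundle of finite rank `P → N`, given by an atlas of smooth local trivializations
whose transition functions are affine on the fibres. -/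
structure AffineBundle (P N : SmoothManifold.{u}) : Type u where
  rank : ℕ
  proj : P → N
  atlas : Set (Trivialization (Fin rank → ℝ) proj)
  exists_mem_baseSet : ∀ x, ∃ e ∈ atlas, x ∈ e.baseSet
  isSmooth : ∀ e ∈ atlas, IsSmoothTrivialization e
  isAffine : ∀ e ∈ atlas, ∀ e' ∈ atlas, ∀ x ∈ e.baseSet ∩ e'.baseSet,
    ∃ g : (Fin rank → ℝ) →ᵃ[ℝ] (Fin rank → ℝ), ∀ y, e.coordChange e' x y = g y

namespace AffineBundle

variable {P N : SmoothManifold.{u}} (A : AffineBundle P N)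

theorem contMDiff_proj : ContMDiff P.I N.I ∞ A.proj :=
  contMDiff_of_smoothTrivializations fun x =>
    let ⟨e, he, hx⟩ := A.exists_mem_baseSet x
    ⟨e, A.isSmooth e he, hx⟩

/-- The projection as a bundled smooth map. -/
def projMap : C^∞⟮P.I, P; N.I, N⟯ := ⟨A.proj, A.contMDiff_proj⟩

/-- The linear map with columns `c (e_j) - c 0`; for affine `c` this is the linear part of `c`. -/
def linearPart {n : ℕ} (c : (Fin n → ℝ) → (Fin n → ℝ)) : (Fin n → ℝ) →L[ℝ] (Fin n → ℝ) :=
  ∑ j, (ContinuousLinearMap.proj (R := ℝ) (φ := fun _ : Fin n => ℝ) j).smulRight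
    (c (Pi.single j 1) - c 0)

theorem linearPart_eq {n : ℕ} {c : (Fin n → ℝ) → (Fin n → ℝ)}
    (g : (Fin n → ℝ) →ᵃ[ℝ] (Fin n → ℝ)) (h : ∀ y, c y = g y) (y : Fin n → ℝ) :
    linearPart c y = g.linear y := by
  have h1 : ∀ z, c z - c 0 = g.linear z := by
    intro z
    rw [h, h, ← vsub_eq_sub, ← g.linearMap_vsub]
    simp
  simp only [linearPart, h1, sum_apply,
    ContinuousLinearMap.smulRight_apply, ContinuousLinearMap.proj_apply]
  conv_rhs => rw [pi_eq_sum_univ' y, map_sum]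
  simp [Pi.single]

theorem linearPart_comp {n : ℕ} {c c' c'' : (Fin n → ℝ) → (Fin n → ℝ)}
    {g g' g'' : (Fin n → ℝ) →ᵃ[ℝ] (Fin n → ℝ)} (h : ∀ y, c y = g y) (h' : ∀ y, c' y = g' y)
    (h'' : ∀ y, c'' y = g'' y) (hc : ∀ y, c' (c y) = c'' y) (y : Fin n → ℝ) :
    linearPart c' (linearPart c y) = linearPart c'' y := by
  have hg : g'.comp g = g'' := by
    ext1 z
    rw [AffineMap.comp_apply, ← h, ← h', hc, h'']
  rw [linearPart_eq g h, linearPart_eq g' h', linearPart_eq g'' h'', ← hg]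
  rfl

theorem contMDiffOn_linearPart (e e' : A.atlas) :
    ContMDiffOn N.I 𝓘(ℝ, (Fin A.rank → ℝ) →L[ℝ] (Fin A.rank → ℝ)) ∞
      (fun x => linearPart (e.1.coordChange e'.1 x)) (e.1.baseSet ∩ e'.1.baseSet) := by
  have hc := (A.isSmooth e e.2).contMDiffOn_coordChange (A.isSmooth e' e'.2)
  have h (z : Fin A.rank → ℝ) : ContMDiffOn N.I 𝓘(ℝ, Fin A.rank → ℝ) ∞
      (fun x => e.1.coordChange e'.1 x z) (e.1.baseSet ∩ e'.1.baseSet) :=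
    hc.comp (contMDiffOn_id.prodMk contMDiffOn_const) (fun x hx => ⟨hx, mem_univ _⟩)
  unfold linearPart
  refine contMDiffOn_finsetSum fun j _ => ?_
  exact (((ContinuousLinearMap.smulRightL ℝ (Fin A.rank → ℝ) (Fin A.rank → ℝ))
    (ContinuousLinearMap.proj j)).contMDiff).comp_contMDiffOn ((h _).sub (h 0))

/-- The cocycle of the model vector bundle: the linear parts of the affine transition functions. -/
def modelCore : VectorBundleCore ℝ N (Fin A.rank → ℝ) A.atlas where
  baseSet e := e.1.baseSet
  isOpen_baseSet e := e.1.open_baseSet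
  indexAt x := ⟨(A.exists_mem_baseSet x).choose, (A.exists_mem_baseSet x).choose_spec.1⟩
  mem_baseSet_at x := (A.exists_mem_baseSet x).choose_spec.2
  coordChange e e' x := linearPart (e.1.coordChange e'.1 x)
  coordChange_self e x hx y := by
    rw [linearPart_eq (AffineMap.id ℝ _) (fun z => e.1.coordChange_same_apply hx z)]
    rfl
  continuousOn_coordChange e e' := (A.contMDiffOn_linearPart e e').continuousOn
  coordChange_comp e e' e'' x hx y := by
    obtain ⟨g, hg⟩ := A.isAffine e e.2 e' e'.2 x hx.1
    obtain ⟨g', hg'⟩ := A.isAffine e' e'.2 e'' e''.2 x ⟨hx.1.2, hx.2⟩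
    obtain ⟨g'', hg''⟩ := A.isAffine e e.2 e'' e''.2 x ⟨hx.1.1, hx.2⟩
    exact linearPart_comp hg hg' hg''
      (fun z => e.1.coordChange_coordChange e'.1 e''.1 hx.1.1 hx.1.2 z) y

instance : A.modelCore.IsContMDiff N.I ∞ := ⟨A.contMDiffOn_linearPart⟩

/-- The model vector bundle `v(A) → N` of an affine bundle. -/
def model : SmoothVectorBundle.{u, 0} N where
  rank := A.rank
  fiber := A.modelCore.Fiber

end AffineBundle

/-! ### Affine towers -/

/-- A tower `B_k → ⋯ → B_1 → B_0` of affine bundles. -/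
structure AffineTower (k : ℕ) : Type (u + 1) where
  level : Fin (k + 1) → SmoothManifold.{u}
  bundle : ∀ i : Fin k, AffineBundle (level i.succ) (level i.castSucc)

namespace AffineTower

variable {k : ℕ}

/-- The base `M = B_0` of the tower. -/
abbrev base (T : AffineTower.{u} k) : SmoothManifold.{u} := T.level 0

/-- The composed projection `B_i → B_0`. -/
def toBase (T : AffineTower.{u} k) :
    ∀ i : Fin (k + 1), C^∞⟮(T.level i).I, T.level i; T.base.I, T.base⟯ :=
  Fin.induction ContMDiffMap.id fun i f => f.comp (T.bundle i).projMap

/-- An isomorphism of affine towers: diffeomorphisms of all levels which commute with the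
projections and are affine on the fibres of the affine bundles. -/
structure Iso (T T' : AffineTower.{u} k) where
  toDiffeomorph : ∀ i, Diffeomorph (T.level i).I (T'.level i).I (T.level i) (T'.level i) ∞
  comm : ∀ (i : Fin k) (b : T.level i.succ),
    (T'.bundle i).proj (toDiffeomorph i.succ b) = toDiffeomorph i.castSucc ((T.bundle i).proj b)
  isAffine : ∀ (i : Fin k), ∀ e ∈ (T.bundle i).atlas, ∀ e' ∈ (T'.bundle i).atlas,
    ∀ x ∈ e.baseSet, toDiffeomorph i.castSucc x ∈ e'.baseSet →
      ∃ g : (Fin (T.bundle i).rank → ℝ) →ᵃ[ℝ] (Fin (T'.bundle i).rank → ℝ),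
        ∀ y, (e' (toDiffeomorph i.succ (e.toOpenPartialHomeomorph.symm (x, y)))).2 = g y

end AffineTower

/-! ### Weighted polynomials and filtered bundles -/

/-- The fibre coordinates of rank `(d_1, …, d_k)`: for each weight, `d w` coordinates.
The index `w : Fin k` stands for the weight `w + 1`. -/
abbrev Coord {k : ℕ} (d : Fin k → ℕ) : Type := Σ w : Fin k, Fin (d w)

/-- The weight of a fibre coordinate, a number in `{1, …, k}`. -/
def Coord.weight {k : ℕ} {d : Fin k → ℕ} (s : Coord d) : ℕ := s.1.val + 1

/-- A family of maps `ℝ^d → ℝ^d'` depending on a point of `U ⊆ M`, each of whose components of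
weight `w` is a weighted polynomial of degree `≤ w`, with coefficients smooth on `U`. -/
def IsWeightedPolynomial (M : SmoothManifold.{u}) {k k' : ℕ} {d : Fin k → ℕ} {d' : Fin k' → ℕ}
    (U : Set M) (g : M → (Coord d → ℝ) → (Coord d' → ℝ)) : Prop :=
  ∃ P : M → Coord d' → MvPolynomial (Coord d) ℝ,
    (∀ s m, ContMDiffOn M.I 𝓘(ℝ) ∞ (fun x => (P x s).coeff m) U) ∧
    ∀ x ∈ U, ∀ s, (P x s).weightedTotalDegree Coord.weight ≤ s.weight ∧
      ∀ y, g x y s = MvPolynomial.eval y (P x s)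

/-- A filtered bundle of degree `k` over `M`: a bundle with typical fibre `ℝ^d`, with an atlas of
smooth local trivializations whose transition functions are weighted polynomials respecting the
degree. -/
structure FilteredBundle (k : ℕ) (M : SmoothManifold.{u}) : Type (u + 1) where
  rank : Fin k → ℕ
  total : SmoothManifold.{u}
  proj : total → M
  atlas : Set (Trivialization (Coord rank → ℝ) proj)
  exists_mem_baseSet : ∀ x, ∃ e ∈ atlas, x ∈ e.baseSet
  isSmooth : ∀ e ∈ atlas, IsSmoothTrivialization e
  isFiltered : ∀ e ∈ atlas, ∀ e' ∈ atlas,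
    IsWeightedPolynomial M (e.baseSet ∩ e'.baseSet) (e.coordChange e')

namespace FilteredBundle

variable {k : ℕ} {M : SmoothManifold.{u}}

/-- A map of filtered bundles over the identity of the base is filtered if, in the filtered
charts, it is given by weighted polynomials respecting the degree. -/
def IsFilteredMap (F F' : FilteredBundle.{u} k M) (f : F.total → F'.total) : Prop :=
  (∀ p, F'.proj (f p) = F.proj p) ∧
    ∀ e ∈ F.atlas, ∀ e' ∈ F'.atlas, IsWeightedPolynomial M (e.baseSet ∩ e'.baseSet)
      (fun x y => (e' (f (e.toOpenPartialHomeomorph.symm (x, y)))).2)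

/-- An isomorphism of filtered bundles over the identity of the base. -/
structure Iso (F F' : FilteredBundle.{u} k M) where
  toDiffeomorph : Diffeomorph F.total.I F'.total.I F.total F'.total ∞
  isFilteredMap : IsFilteredMap F F' toDiffeomorph
  isFilteredMap_symm : IsFilteredMap F' F toDiffeomorph.symm

/-! ### The tower of a filtered bundle -/

/-- The coordinates of weight at most `l`. -/
abbrev LowCoord (d : Fin k → ℕ) (l : ℕ) : Type := {s : Coord d // s.weight ≤ l}

/-- Forget the coordinates of weight greater than `l`. -/
def truncate {d : Fin k → ℕ} (l : ℕ) (y : Coord d → ℝ) : LowCoord d l → ℝ := fun s => y s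

/-- Put the coordinates of weight greater than `l` equal to zero. -/
def extendZero {d : Fin k → ℕ} (l : ℕ) (y : LowCoord d l → ℝ) : Coord d → ℝ :=
  fun s => if h : s.weight ≤ l then y ⟨s, h⟩ else 0

theorem truncate_extendZero {d : Fin k → ℕ} (l : ℕ) (y : LowCoord d l → ℝ) :
    truncate l (extendZero l y) = y := by
  ext s
  simp [truncate, extendZero, s.2]

theorem contDiff_truncate {d : Fin k → ℕ} (l : ℕ) :
    ContDiff ℝ ∞ (truncate (d := d) l) :=
  contDiff_pi.2 fun s => contDiff_apply ℝ ℝ s.1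

theorem contDiff_extendZero {d : Fin k → ℕ} (l : ℕ) :
    ContDiff ℝ ∞ (extendZero (d := d) l) := by
  refine contDiff_pi.2 fun s => ?_
  by_cases h : s.weight ≤ l
  · simpa [extendZero, h] using contDiff_apply ℝ ℝ (⟨s, h⟩ : LowCoord d l)
  · simpa [extendZero, h] using contDiff_const

theorem weight_le_of_mem_support {d : Fin k → ℕ} {p : MvPolynomial (Coord d) ℝ} {n : ℕ}
    (hp : p.weightedTotalDegree Coord.weight ≤ n) {m : Coord d →₀ ℕ} (hm : m ∈ p.support) :
    Finsupp.weight Coord.weight m ≤ n :=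
  (MvPolynomial.le_weightedTotalDegree _ hm).trans hp

/-- A polynomial of weighted degree `≤ l` only depends on the coordinates of weight `≤ l`. -/
theorem eval_eq_of_truncate_eq {d : Fin k → ℕ} {p : MvPolynomial (Coord d) ℝ} {n l : ℕ}
    (hp : p.weightedTotalDegree Coord.weight ≤ n) (hn : n ≤ l) {y z : Coord d → ℝ}
    (h : truncate l y = truncate l z) : MvPolynomial.eval y p = MvPolynomial.eval z p := by
  rw [MvPolynomial.eval_eq, MvPolynomial.eval_eq]
  refine Finset.sum_congr rfl fun m hm => ?_
  congr 1
  refine Finset.prod_congr rfl fun s hs => ?_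
  have h1 : s.weight ≤ l :=
    (Finsupp.le_weight_of_ne_zero' Coord.weight (Finsupp.mem_support_iff.1 hs)).trans
      ((weight_le_of_mem_support hp hm).trans hn)
  rw [show y s = z s from congrFun h ⟨s, h1⟩]

variable (F : FilteredBundle.{u} k M)

theorem truncate_coordChange_congr (e e' : F.atlas) {l : ℕ} {x : M}
    (hx : x ∈ e.1.baseSet ∩ e'.1.baseSet) {y z : Coord F.rank → ℝ}
    (h : truncate l y = truncate l z) :
    truncate l (e.1.coordChange e'.1 x y) = truncate l (e.1.coordChange e'.1 x z) := by
  obtain ⟨P, -, hP⟩ := F.isFiltered e e.2 e' e'.2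
  ext s
  obtain ⟨h1, h2⟩ := hP x hx s
  simp only [truncate, h2]
  exact eval_eq_of_truncate_eq h1 s.2 h

/-- The transition functions of `F` restricted to the coordinates of weight at most `l`. -/
def truncCoordChange (l : ℕ) (e e' : F.atlas) (x : M) (y : LowCoord F.rank l → ℝ) :
    LowCoord F.rank l → ℝ :=
  truncate l (e.1.coordChange e'.1 x (extendZero l y))

theorem contMDiffOn_truncCoordChange (l : ℕ) (e e' : F.atlas) :
    ContMDiffOn (M.I.prod 𝓘(ℝ, LowCoord F.rank l → ℝ)) 𝓘(ℝ, LowCoord F.rank l → ℝ) ∞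
      (fun p : M × (LowCoord F.rank l → ℝ) => F.truncCoordChange l e e' p.1 p.2)
      ((e.1.baseSet ∩ e'.1.baseSet) ×ˢ univ) := by
  have hc := (F.isSmooth e e.2).contMDiffOn_coordChange (F.isSmooth e' e'.2)
  refine (contDiff_truncate l).contMDiff.comp_contMDiffOn
    (hc.comp (contMDiffOn_fst.prodMk
      ((contDiff_extendZero l).contMDiff.comp_contMDiffOn contMDiffOn_snd)) ?_)
  exact fun p hp => ⟨hp.1, mem_univ _⟩

/-- The bundle obtained from the atlas of `F` by removing all coordinates of weight greater
than `l`. -/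
def truncCore (l : ℕ) : FiberBundleCore F.atlas M (LowCoord F.rank l → ℝ) where
  baseSet e := e.1.baseSet
  isOpen_baseSet e := e.1.open_baseSet
  indexAt x := ⟨(F.exists_mem_baseSet x).choose, (F.exists_mem_baseSet x).choose_spec.1⟩
  mem_baseSet_at x := (F.exists_mem_baseSet x).choose_spec.2
  coordChange := F.truncCoordChange l
  coordChange_self e x hx y := by
    rw [truncCoordChange, e.1.coordChange_same_apply hx, truncate_extendZero]
  continuousOn_coordChange e e' := (F.contMDiffOn_truncCoordChange l e e').continuousOn
  coordChange_comp e e' e'' x hx y := by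
    unfold truncCoordChange
    rw [F.truncate_coordChange_congr e' e'' ⟨hx.1.2, hx.2⟩ (truncate_extendZero l _),
      e.1.coordChange_coordChange e'.1 e''.1 hx.1.1 hx.1.2]

theorem isSmoothCore_truncCore (l : ℕ) : IsSmoothCore (F.truncCore l) :=
  F.contMDiffOn_truncCoordChange l

/-- The manifold `F_{l}`. -/
def truncLevel (l : ℕ) : SmoothManifold.{u} :=
  coreManifold (F.truncCore l) (F.isSmoothCore_truncCore l)

/-- Forget the coordinates of weight `l + 1`. -/
def truncateSucc {d : Fin k → ℕ} (l : ℕ) (y : LowCoord d (l + 1) → ℝ) : LowCoord d l → ℝ :=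
  fun s => y ⟨s.1, s.2.trans l.le_succ⟩

/-- The projection `F_{l+1} → F_{l}`. -/
def truncProj (l : ℕ) (p : F.truncLevel (l + 1)) : F.truncLevel l :=
  (⟨p.proj, truncateSucc l p.snd⟩ : TotalSpace _ (F.truncCore l).Fiber)

/-- Split the coordinates of weight `≤ i + 1` in those of weight `≤ i` and of weight `i + 1`. -/
def splitCoord (d : Fin k → ℕ) (i : Fin k) :
    (LowCoord d (i.val + 1) → ℝ) ≃L[ℝ] (LowCoord d i.val → ℝ) × (Fin (d i) → ℝ) :=
  LinearEquiv.toContinuousLinearEquiv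
  { toFun := fun y => (truncateSucc i.val y, fun j => y ⟨⟨i, j⟩, le_rfl⟩)
    invFun := fun z s => if h : s.1.weight ≤ i.val then z.1 ⟨s.1, h⟩ else
      z.2 (Fin.cast (congrArg d (Fin.ext (by
        have := s.2
        simp only [Coord.weight] at this h
        omega))) s.1.2)
    map_add' := fun _ _ => rfl
    map_smul' := fun _ _ => rfl
    left_inv := by
      intro y
      ext ⟨⟨w, j⟩, hs⟩
      by_cases h : Coord.weight (⟨w, j⟩ : Coord d) ≤ i.val
      · simp [h, truncateSucc]
      · have hw : w = i := by
          ext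
          simp only [Coord.weight] at hs h
          omega
        subst hw
        simp [h]
    right_inv := by
      rintro ⟨a, b⟩
      refine Prod.ext ?_ ?_
      · ext s
        simp [truncateSucc, s.2]
      · ext j
        simp [Coord.weight] }

/-- The projection `F_{l} → M`. -/
def truncBase (l : ℕ) (p : F.truncLevel l) : M :=
  TotalSpace.proj (E := (F.truncCore l).Fiber) p

/-- The trivialization of `F_{l} → M` given by the coordinates of weight at most `l`. -/
def truncTriv (l : ℕ) (e : F.atlas) : Trivialization (LowCoord F.rank l → ℝ) (F.truncBase l) :=
  (F.truncCore l).localTriv e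

theorem isSmooth_truncTriv (l : ℕ) (e : F.atlas) : IsSmoothTrivialization (F.truncTriv l e) :=
  isSmoothTrivialization_localTriv _ (F.isSmoothCore_truncCore l) e

theorem truncBase_truncProj (l : ℕ) (p : F.truncLevel (l + 1)) :
    F.truncBase l (F.truncProj l p) = F.truncBase (l + 1) p := rfl

theorem truncCoordChange_truncateSucc (l : ℕ) (e e' : F.atlas) {x : M}
    (hx : x ∈ e.1.baseSet ∩ e'.1.baseSet) (y : LowCoord F.rank (l + 1) → ℝ) :
    F.truncCoordChange l e e' x (truncateSucc l y) =
      truncateSucc l (F.truncCoordChange (l + 1) e e' x y) := by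
  refine F.truncate_coordChange_congr e e' hx ?_
  ext s
  have := s.2
  simp [truncate, extendZero, truncateSucc, this, this.trans l.le_succ]

theorem truncTriv_truncProj (l : ℕ) (e : F.atlas) {p : F.truncLevel (l + 1)}
    (hp : F.truncBase (l + 1) p ∈ e.1.baseSet) :
    F.truncTriv l e (F.truncProj l p) =
      (F.truncBase (l + 1) p, truncateSucc l (F.truncTriv (l + 1) e p).2) := by
  refine Prod.ext rfl ?_
  exact F.truncCoordChange_truncateSucc l _ e ⟨(F.truncCore l).mem_baseSet_at _, hp⟩ _

theorem mem_truncTriv_source {l : ℕ} {e : F.atlas} {p : F.truncLevel l} :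
    p ∈ (F.truncTriv l e).source ↔ F.truncBase l p ∈ e.1.baseSet := Iff.rfl

theorem mem_truncTriv_target {l : ℕ} {e : F.atlas} {q : M × (LowCoord F.rank l → ℝ)} :
    q ∈ (F.truncTriv l e).target ↔ q.1 ∈ e.1.baseSet := (F.truncTriv l e).mem_target

/-- In the chart `e`, the pair consisting of the projection to `F_{i}` and the coordinates of
weight `i + 1`. -/
def levelTrivFun (i : Fin k) (e : F.atlas) (p : F.truncLevel (i.val + 1)) :
    F.truncLevel i.val × (Fin (F.rank i) → ℝ) :=
  (F.truncProj i.val p, (splitCoord F.rank i (F.truncTriv (i.val + 1) e p).2).2)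

/-- The inverse of `levelTrivFun`. -/
def levelTrivInv (i : Fin k) (e : F.atlas) (q : F.truncLevel i.val × (Fin (F.rank i) → ℝ)) :
    F.truncLevel (i.val + 1) :=
  (F.truncTriv (i.val + 1) e).toOpenPartialHomeomorph.symm
    (F.truncBase i.val q.1, (splitCoord F.rank i).symm ((F.truncTriv i.val e q.1).2, q.2))

theorem truncBase_levelTrivInv (i : Fin k) (e : F.atlas)
    (q : F.truncLevel i.val × (Fin (F.rank i) → ℝ)) :
    F.truncBase (i.val + 1) (F.levelTrivInv i e q) = F.truncBase i.val q.1 := rfl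

theorem truncTriv_levelTrivInv (i : Fin k) (e : F.atlas)
    {q : F.truncLevel i.val × (Fin (F.rank i) → ℝ)} (hq : F.truncBase i.val q.1 ∈ e.1.baseSet) :
    F.truncTriv (i.val + 1) e (F.levelTrivInv i e q) =
      (F.truncBase i.val q.1, (splitCoord F.rank i).symm ((F.truncTriv i.val e q.1).2, q.2)) :=
  (F.truncTriv (i.val + 1) e).apply_symm_apply (F.mem_truncTriv_target.2 hq)

theorem splitCoord_fst (d : Fin k → ℕ) (i : Fin k) (y : LowCoord d (i.val + 1) → ℝ) :
    (splitCoord d i y).1 = truncateSucc i.val y := rfl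

theorem truncateSucc_splitCoord_symm (d : Fin k → ℕ) (i : Fin k)
    (z : (LowCoord d i.val → ℝ) × (Fin (d i) → ℝ)) :
    truncateSucc i.val ((splitCoord d i).symm z) = z.1 := by
  rw [← splitCoord_fst, ContinuousLinearEquiv.apply_symm_apply]

theorem contMDiffOn_truncProj (l : ℕ) (e : F.atlas) :
    ContMDiffOn (F.truncLevel (l + 1)).I (F.truncLevel l).I ∞ (F.truncProj l)
      (F.truncTriv (l + 1) e).source := by
  have h1 := (F.isSmooth_truncTriv (l + 1) e).1
  have h2 := (F.isSmooth_truncTriv l e).2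
  have h3 : ContDiff ℝ ∞ (truncateSucc (d := F.rank) l) :=
    contDiff_pi.2 fun s => contDiff_apply ℝ ℝ _
  have h4 := h2.comp ((contMDiff_fst.comp_contMDiffOn h1).prodMk
    (h3.contMDiff.comp_contMDiffOn (contMDiff_snd.comp_contMDiffOn h1)))
    (fun p hp => F.mem_truncTriv_target.2 (F.mem_truncTriv_source.1 hp))
  refine h4.congr fun p hp => ?_
  have h5 := F.truncTriv_truncProj l e (p := p) hp
  have h6 : F.truncProj l p ∈ (F.truncTriv l e).source := hp
  rw [← (F.truncTriv l e).toOpenPartialHomeomorph.left_inv h6]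
  exact congrArg _ h5

theorem contMDiffOn_levelTrivFun (i : Fin k) (e : F.atlas) :
    ContMDiffOn (F.truncLevel (i.val + 1)).I
      ((F.truncLevel i.val).I.prod 𝓘(ℝ, Fin (F.rank i) → ℝ)) ∞ (F.levelTrivFun i e)
      (F.truncTriv (i.val + 1) e).source := by
  have h1 := (F.isSmooth_truncTriv (i.val + 1) e).1
  refine (F.contMDiffOn_truncProj i.val e).prodMk ?_
  exact ((contDiff_snd.comp (splitCoord F.rank i).contDiff).contMDiff).comp_contMDiffOn
    (contMDiff_snd.comp_contMDiffOn h1)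

theorem contMDiffOn_levelTrivInv (i : Fin k) (e : F.atlas) :
    ContMDiffOn ((F.truncLevel i.val).I.prod 𝓘(ℝ, Fin (F.rank i) → ℝ))
      (F.truncLevel (i.val + 1)).I ∞ (F.levelTrivInv i e)
      ((F.truncTriv i.val e).source ×ˢ univ) := by
  have h1 := (F.isSmooth_truncTriv i.val e).1
  have h2 := (F.isSmooth_truncTriv (i.val + 1) e).2
  have h3 : ContMDiffOn ((F.truncLevel i.val).I.prod 𝓘(ℝ, Fin (F.rank i) → ℝ))
      (M.I.prod 𝓘(ℝ, LowCoord F.rank i.val → ℝ)) ∞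
      (fun q : F.truncLevel i.val × (Fin (F.rank i) → ℝ) => F.truncTriv i.val e q.1)
      ((F.truncTriv i.val e).source ×ˢ univ) :=
    h1.comp contMDiffOn_fst fun q hq => hq.1
  have h4 := (contMDiff_snd.comp_contMDiffOn h3).prodMk_space
    (contMDiffOn_snd (s := (F.truncTriv i.val e).source ×ˢ (univ : Set (Fin (F.rank i) → ℝ)))
      (I := (F.truncLevel i.val).I) (J := 𝓘(ℝ, Fin (F.rank i) → ℝ)))
  have h5 := ((splitCoord F.rank i).symm.contDiff (n := ∞)).contMDiff.comp_contMDiffOn h4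
  exact h2.comp ((contMDiff_fst.comp_contMDiffOn h3).prodMk h5)
    (fun q hq => F.mem_truncTriv_target.2 hq.1)

/-- The trivialization of `F_{i+1} → F_{i}` given by the coordinates of weight `i + 1` of a
filtered chart. -/
def levelTriv (i : Fin k) (e : F.atlas) :
    Trivialization (Fin (F.rank i) → ℝ) (F.truncProj i.val) where
  toFun := F.levelTrivFun i e
  invFun := F.levelTrivInv i e
  source := (F.truncTriv (i.val + 1) e).source
  target := (F.truncTriv i.val e).source ×ˢ univ
  map_source' p hp := ⟨hp, mem_univ _⟩
  map_target' q hq := hq.1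
  left_inv' p hp := by
    have h1 := F.truncTriv_truncProj i.val e (p := p) hp
    have h2 : F.levelTrivInv i e (F.levelTrivFun i e p) =
        (F.truncTriv (i.val + 1) e).toOpenPartialHomeomorph.symm
          (F.truncTriv (i.val + 1) e p) := by
      unfold levelTrivInv levelTrivFun
      refine congrArg _ (Prod.ext rfl ?_)
      dsimp only
      rw [h1]
      exact (splitCoord F.rank i).symm_apply_apply (F.truncTriv (i.val + 1) e p).2
    rw [h2]
    exact (F.truncTriv (i.val + 1) e).toOpenPartialHomeomorph.left_inv hp
  right_inv' q hq := by
    have hq1 : F.truncBase i.val q.1 ∈ e.1.baseSet := hq.1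
    have h1 := F.truncTriv_levelTrivInv i e hq1
    refine Prod.ext ?_ ?_
    · have h2 : F.levelTrivInv i e q ∈ (F.truncTriv (i.val + 1) e).source := hq1
      refine (F.truncTriv i.val e).injOn 
        (show F.truncProj i.val (F.levelTrivInv i e q) ∈ (F.truncTriv i.val e).source from hq1) hq.1 ?_
      refine (F.truncTriv_truncProj i.val e h2).trans ?_
      rw [h1, truncateSucc_splitCoord_symm]
      rfl
    · change (splitCoord F.rank i (F.truncTriv (i.val + 1) e (F.levelTrivInv i e q)).2).2 = q.2
      rw [h1]
      simp
  open_source := (F.truncTriv (i.val + 1) e).open_source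
  open_target := (F.truncTriv i.val e).open_source.prod isOpen_univ
  continuousOn_toFun := (F.contMDiffOn_levelTrivFun i e).continuousOn
  continuousOn_invFun := (F.contMDiffOn_levelTrivInv i e).continuousOn
  baseSet := (F.truncTriv i.val e).source
  open_baseSet := (F.truncTriv i.val e).open_source
  source_eq := rfl
  target_eq := rfl
  proj_toFun _ _ := rfl

theorem isSmooth_levelTriv (i : Fin k) (e : F.atlas) : IsSmoothTrivialization (F.levelTriv i e) :=
  ⟨F.contMDiffOn_levelTrivFun i e, F.contMDiffOn_levelTrivInv i e⟩

/-- A monomial of weighted degree `≤ n` is affine in the coordinates of weight `n`. -/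
theorem exists_affine_monomial {d : Fin k → ℕ} {V : Type*} [AddCommGroup V] [Module ℝ V] {n : ℕ}
    (y : V → Coord d → ℝ) (hlow : ∀ s, s.weight < n → ∀ z z', y z s = y z' s)
    (htop : ∀ s, s.weight = n → ∃ g : V →ᵃ[ℝ] ℝ, ∀ z, y z s = g z)
    {m : Coord d →₀ ℕ} (hm : Finsupp.weight Coord.weight m ≤ n) :
    ∃ g : V →ᵃ[ℝ] ℝ, ∀ z, ∏ s ∈ m.support, y z s ^ m s = g z := by
  classical
  by_cases h : ∃ s, m s ≠ 0 ∧ n ≤ s.weight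
  · obtain ⟨s, hs, hn⟩ := h
    have hw : 0 < s.weight := Nat.succ_pos _
    have hsum : ∑ t ∈ m.support, m t * Coord.weight t ≤ n := by
      simpa [Finsupp.weight_apply, Finsupp.sum] using hm
    have hmem : s ∈ m.support := Finsupp.mem_support_iff.2 hs
    rw [← Finset.add_sum_erase _ _ hmem] at hsum
    have h1 : 1 ≤ m s := Nat.one_le_iff_ne_zero.2 hs
    have h2 : s.weight ≤ m s * s.weight := Nat.le_mul_of_pos_left _ h1
    have hse : s.weight = n := by omega
    have hms : m s = 1 := by
      by_contra hne
      have : 2 * s.weight ≤ m s * s.weight := Nat.mul_le_mul_right _ (by omega)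
      omega
    have hrest : ∑ t ∈ m.support.erase s, m t * Coord.weight t = 0 := by omega
    have hempty : m.support = {s} := by
      ext t
      rw [Finset.mem_singleton]
      constructor
      · intro ht
        by_contra hts
        have := Finset.sum_eq_zero_iff.1 hrest t (Finset.mem_erase.2 ⟨hts, ht⟩)
        rcases Nat.mul_eq_zero.1 this with h' | h'
        · exact Finsupp.mem_support_iff.1 ht h'
        · exact Nat.succ_ne_zero _ h'
      · rintro rfl
        exact hmem
    obtain ⟨g, hg⟩ := htop s hse
    refine ⟨g, fun z => ?_⟩
    rw [hempty, Finset.prod_singleton, hms, pow_one, hg]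
  · push Not at h
    refine ⟨AffineMap.const ℝ V (∏ s ∈ m.support, y 0 s ^ m s), fun z => ?_⟩
    refine Finset.prod_congr rfl fun s hs => ?_
    rw [hlow s (h s (Finsupp.mem_support_iff.1 hs)) z 0]

theorem exists_affine_eval {d : Fin k → ℕ} {V : Type*} [AddCommGroup V] [Module ℝ V] {n : ℕ}
    (y : V → Coord d → ℝ) (hlow : ∀ s, s.weight < n → ∀ z z', y z s = y z' s)
    (htop : ∀ s, s.weight = n → ∃ g : V →ᵃ[ℝ] ℝ, ∀ z, y z s = g z)
    {p : MvPolynomial (Coord d) ℝ} (hp : p.weightedTotalDegree Coord.weight ≤ n) :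
    ∃ g : V →ᵃ[ℝ] ℝ, ∀ z, MvPolynomial.eval (y z) p = g z := by
  have h (m : Coord d →₀ ℕ) : ∃ g : V →ᵃ[ℝ] ℝ, ∀ z,
      p.coeff m * ∏ s ∈ m.support, y z s ^ m s = g z := by
    by_cases hm : m ∈ p.support
    · obtain ⟨g, hg⟩ := exists_affine_monomial y hlow htop (weight_le_of_mem_support hp hm)
      exact ⟨p.coeff m • g, fun z => by rw [hg]; rfl⟩
    · refine ⟨0, fun z => ?_⟩
      rw [MvPolynomial.notMem_support_iff.1 hm, zero_mul]
      rfl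
  choose g hg using h
  refine ⟨∑ m ∈ p.support, g m, fun z => ?_⟩
  rw [MvPolynomial.eval_eq, Finset.sum_congr rfl fun m _ => hg m z]
  induction p.support using Finset.cons_induction with
  | empty => rfl
  | cons a s ha ih => rw [Finset.sum_cons, Finset.sum_cons, ih]; rfl

theorem isAffine_levelTriv (i : Fin k) (e e' : F.atlas) (x : F.truncLevel i.val)
    (hx : x ∈ (F.levelTriv i e).baseSet ∩ (F.levelTriv i e').baseSet) :
    ∃ g : (Fin (F.rank i) → ℝ) →ᵃ[ℝ] (Fin (F.rank i) → ℝ),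
      ∀ z, (F.levelTriv i e).coordChange (F.levelTriv i e') x z = g z := by
  obtain ⟨P, -, hP⟩ := F.isFiltered e e.2 e' e'.2
  have hx' : F.truncBase i.val x ∈ e.1.baseSet ∩ e'.1.baseSet := hx
  set a := (F.truncTriv i.val e x).2
  have key (z : Fin (F.rank i) → ℝ) (j : Fin (F.rank i)) :
      (F.levelTriv i e).coordChange (F.levelTriv i e') x z j =
        MvPolynomial.eval (extendZero (i.val + 1) ((splitCoord F.rank i).symm (a, z)))
          (P (F.truncBase i.val x) ⟨i, j⟩) := by
    rw [← (hP _ hx' ⟨i, j⟩).2]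
    have h1 : (F.truncTriv (i.val + 1) e' (F.levelTrivInv i e (x, z))).2 =
        F.truncCoordChange (i.val + 1) e e' (F.truncBase i.val x)
          ((splitCoord F.rank i).symm (a, z)) := by
      exact (F.truncCore (i.val + 1)).coordChange_comp e _ e' _
        ⟨⟨hx'.1, (F.truncCore (i.val + 1)).mem_baseSet_at _⟩, hx'.2⟩ _
    change (splitCoord F.rank i (F.truncTriv (i.val + 1) e' (F.levelTrivInv i e (x, z))).2).2 j = _
    rw [h1]
    rfl
  have haff (j : Fin (F.rank i)) : ∃ g : (Fin (F.rank i) → ℝ) →ᵃ[ℝ] ℝ, ∀ z,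
      (F.levelTriv i e).coordChange (F.levelTriv i e') x z j = g z := by
    simp only [key]
    refine exists_affine_eval _ ?_ ?_ (hP _ hx' ⟨i, j⟩).1
    · intro s hs z z'
      have hs' : s.weight ≤ i.val := Nat.lt_succ_iff.1 hs
      have hs2 : s.weight ≤ i.val + 1 := hs'.trans (Nat.le_succ _)
      have h2 (z : Fin (F.rank i) → ℝ) :
          extendZero (i.val + 1) ((splitCoord F.rank i).symm (a, z)) s = a ⟨s, hs'⟩ := by
        have := congrFun (truncateSucc_splitCoord_symm F.rank i (a, z)) ⟨s, hs'⟩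
        refine Eq.trans ?_ this
        simp [extendZero, hs2, truncateSucc]
      rw [h2, h2]
    · rintro ⟨w, l⟩ hs
      have hw : w = i := by
        ext
        simpa [Coord.weight] using hs
      subst hw
      refine ⟨(LinearMap.proj l : (Fin (F.rank w) → ℝ) →ₗ[ℝ] ℝ).toAffineMap, fun z => ?_⟩
      have h3 : (splitCoord F.rank w ((splitCoord F.rank w).symm (a, z))).2 l = z l := by
        rw [ContinuousLinearEquiv.apply_symm_apply]
      have h4 : Coord.weight (⟨w, l⟩ : Coord F.rank) ≤ w.val + 1 := le_rfl
      change _ = z l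
      rw [← h3]
      simp only [extendZero, h4, dif_pos]
      rfl
  choose g hg using haff
  exact ⟨AffineMap.pi g, fun z => funext fun j => hg j z⟩

/-- The affine bundle `F_{i+1} → F_{i}`. -/
def levelBundle (i : Fin k) : AffineBundle (F.truncLevel (i.val + 1)) (F.truncLevel i.val) where
  rank := F.rank i
  proj := F.truncProj i.val
  atlas := Set.range (F.levelTriv i)
  exists_mem_baseSet x :=
    let ⟨e, he, hx⟩ := F.exists_mem_baseSet (F.truncBase i.val x)
    ⟨_, ⟨⟨e, he⟩, rfl⟩, hx⟩
  isSmooth := by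
    rintro _ ⟨e, rfl⟩
    exact F.isSmooth_levelTriv i e
  isAffine := by
    rintro _ ⟨e, rfl⟩ _ ⟨e', rfl⟩
    exact F.isAffine_levelTriv i e e'

/-- The tower `F_{k} → ⋯ → F_{1} → F_{0}` of affine bundles of a filtered bundle `F`; the
projection `F_{0} → M` is a diffeomorphism. -/
def tower : AffineTower.{u} k where
  level i := F.truncLevel i.val
  bundle i := F.levelBundle i

/-! ### Split filtered bundles -/

/-- The cocycle of the Whitney sum `V_1 ⊕ ⋯ ⊕ V_k`: in the local trivializations of the `V_i`,
the transition functions are block diagonal, with the transition functions of the `V_i` as blocks.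
The charts are indexed by the points of `M`. -/
def splitCoordChange (V : Fin k → SmoothVectorBundle.{u, v} M) (a b x : M)
    (y : Coord (fun i => (V i).rank) → ℝ) : Coord (fun i => (V i).rank) → ℝ :=
  fun s => (trivializationAt (Fin (V s.1).rank → ℝ) (V s.1).fiber a).coordChangeL ℝ
    (trivializationAt (Fin (V s.1).rank → ℝ) (V s.1).fiber b) x (fun j => y ⟨s.1, j⟩) s.2

theorem contMDiffOn_splitCoordChange (V : Fin k → SmoothVectorBundle.{u, v} M) (a b : M) :
    ContMDiffOn (M.I.prod 𝓘(ℝ, Coord (fun i => (V i).rank) → ℝ))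
      𝓘(ℝ, Coord (fun i => (V i).rank) → ℝ) ∞
      (fun p : M × (Coord (fun i => (V i).rank) → ℝ) => splitCoordChange V a b p.1 p.2)
      (((⋂ i, (trivializationAt (Fin (V i).rank → ℝ) (V i).fiber a).baseSet) ∩
        ⋂ i, (trivializationAt (Fin (V i).rank → ℝ) (V i).fiber b).baseSet) ×ˢ univ) := by
  refine contMDiffOn_pi_space.2 fun s => ?_
  have h1 := (contMDiffOn_coordChangeL (n := ∞) (IB := M.I)
    (trivializationAt (Fin (V s.1).rank → ℝ) (V s.1).fiber a)
    (trivializationAt (Fin (V s.1).rank → ℝ) (V s.1).fiber b))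
  have h2 := h1.comp (contMDiffOn_fst (J := 𝓘(ℝ, Coord (fun i => (V i).rank) → ℝ))
    (s := ((⋂ i, (trivializationAt (Fin (V i).rank → ℝ) (V i).fiber a).baseSet) ∩
        ⋂ i, (trivializationAt (Fin (V i).rank → ℝ) (V i).fiber b).baseSet) ×ˢ
        (univ : Set (Coord (fun i => (V i).rank) → ℝ))))
    (fun p hp => ⟨mem_iInter.1 hp.1.1 s.1, mem_iInter.1 hp.1.2 s.1⟩)
  have h3 : ContDiff ℝ ∞ (fun y : Coord (fun i => (V i).rank) → ℝ =>
      fun j : Fin (V s.1).rank => y ⟨s.1, j⟩) :=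
    contDiff_pi.2 fun j => contDiff_apply ℝ ℝ _
  have h4 := h2.clm_apply (h3.contMDiff.comp_contMDiffOn contMDiffOn_snd)
  exact contMDiffOn_pi_space.1 h4 s.2

/-- The Whitney sum `V_1 ⊕ ⋯ ⊕ V_k` as a bundle with typical fibre `ℝ^d`. -/
def splitCore (V : Fin k → SmoothVectorBundle.{u, v} M) :
    FiberBundleCore M M (Coord (fun i => (V i).rank) → ℝ) where
  baseSet a := ⋂ i, (trivializationAt (Fin (V i).rank → ℝ) (V i).fiber a).baseSet
  isOpen_baseSet a := isOpen_iInter_of_finite fun i => Trivialization.open_baseSet _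
  indexAt x := x
  mem_baseSet_at x := mem_iInter.2 fun i => FiberBundle.mem_baseSet_trivializationAt' x
  coordChange := splitCoordChange V
  coordChange_self a x hx y := by
    ext s
    have h := mem_iInter.1 hx s.1
    simp only [splitCoordChange]
    rw [Trivialization.coordChangeL_apply' _ _ ⟨h, h⟩, Trivialization.apply_symm_apply' _ h]
  continuousOn_coordChange a b := (contMDiffOn_splitCoordChange V a b).continuousOn
  coordChange_comp a b c x hx y := by
    ext s
    have ha := mem_iInter.1 hx.1.1 s.1
    have hb := mem_iInter.1 hx.1.2 s.1
    have hc := mem_iInter.1 hx.2 s.1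
    have h := Trivialization.coordChange_coordChange _ _
      (trivializationAt (Fin (V s.1).rank → ℝ) (V s.1).fiber c) ha hb
    have key (z : Fin (V s.1).rank → ℝ) :
        (trivializationAt (Fin (V s.1).rank → ℝ) (V s.1).fiber b).coordChangeL ℝ
          (trivializationAt (Fin (V s.1).rank → ℝ) (V s.1).fiber c) x
          ((trivializationAt (Fin (V s.1).rank → ℝ) (V s.1).fiber a).coordChangeL ℝ
            (trivializationAt (Fin (V s.1).rank → ℝ) (V s.1).fiber b) x z) =
        (trivializationAt (Fin (V s.1).rank → ℝ) (V s.1).fiber a).coordChangeL ℝ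
          (trivializationAt (Fin (V s.1).rank → ℝ) (V s.1).fiber c) x z := by
      rw [Trivialization.coordChangeL_apply' _ _ ⟨ha, hb⟩,
        Trivialization.coordChangeL_apply' _ _ ⟨ha, hc⟩,
        Trivialization.coordChangeL_apply' _ _ ⟨hb, hc⟩]
      exact h z
    exact congrFun (key fun j => y ⟨s.1, j⟩) s.2

theorem isSmoothCore_splitCore (V : Fin k → SmoothVectorBundle.{u, v} M) :
    IsSmoothCore (splitCore V) :=
  contMDiffOn_splitCoordChange V

theorem isWeightedPolynomial_splitCoordChange (V : Fin k → SmoothVectorBundle.{u, v} M) (a b : M) :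
    IsWeightedPolynomial M ((splitCore V).baseSet a ∩ (splitCore V).baseSet b)
      (splitCoordChange V a b) := by
  classical
  let L (i : Fin k) (x : M) : (Fin (V i).rank → ℝ) →L[ℝ] (Fin (V i).rank → ℝ) :=
    (trivializationAt (Fin (V i).rank → ℝ) (V i).fiber a).coordChangeL ℝ
      (trivializationAt (Fin (V i).rank → ℝ) (V i).fiber b) x
  have hcoeff (x : M) (s : Coord fun i => (V i).rank) (m : (Coord fun i => (V i).rank) →₀ ℕ) :
      (∑ j, MvPolynomial.C (L s.1 x (Pi.single j 1) s.2) *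
        MvPolynomial.X (R := ℝ) (⟨s.1, j⟩ : Coord fun i => (V i).rank)).coeff m =
      ∑ j, L s.1 x (Pi.single j 1) s.2 *
        if Finsupp.single (⟨s.1, j⟩ : Coord fun i => (V i).rank) 1 = m then 1 else 0 := by
    simp only [MvPolynomial.coeff_sum, MvPolynomial.coeff_C_mul, MvPolynomial.coeff_X]
  refine ⟨fun x s => ∑ j, MvPolynomial.C (L s.1 x (Pi.single j 1) s.2) *
    MvPolynomial.X (⟨s.1, j⟩ : Coord fun i => (V i).rank), ?_, ?_⟩
  · intro s m
    simp only [hcoeff]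
    refine contMDiffOn_finsetSum fun j _ => ContMDiffOn.mul ?_ contMDiffOn_const
    have h1 := (contMDiffOn_coordChangeL (n := ∞) (IB := M.I)
      (trivializationAt (Fin (V s.1).rank → ℝ) (V s.1).fiber a)
      (trivializationAt (Fin (V s.1).rank → ℝ) (V s.1).fiber b))
    have h2 := h1.mono (t := (splitCore V).baseSet a ∩ (splitCore V).baseSet b)
      fun x hx => ⟨mem_iInter.1 hx.1 s.1, mem_iInter.1 hx.2 s.1⟩
    exact contMDiffOn_pi_space.1 (h2.clm_apply (contMDiffOn_const (c := Pi.single j (1 : ℝ)))) s.2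
  · intro x _ s
    constructor
    · refine Finset.sup_le fun m hm => ?_
      rw [MvPolynomial.mem_support_iff, hcoeff] at hm
      obtain ⟨j, -, hj⟩ := Finset.exists_ne_zero_of_sum_ne_zero hm
      have hm' : Finsupp.single (⟨s.1, j⟩ : Coord fun i => (V i).rank) 1 = m := by
        by_contra hne
        simp [hne] at hj
      rw [← hm', Finsupp.weight_single, one_smul]
      exact le_rfl
    · intro y
      have hy := pi_eq_sum_univ' (fun j : Fin (V s.1).rank => y ⟨s.1, j⟩)
      change L s.1 x (fun j => y ⟨s.1, j⟩) s.2 = _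
      rw [hy, map_sum, Finset.sum_apply, map_sum]
      refine Finset.sum_congr rfl fun j _ => ?_
      rw [map_smul, Pi.smul_apply, smul_eq_mul, map_mul, MvPolynomial.eval_C, MvPolynomial.eval_X,
        mul_comm]

/-- The split filtered bundle `V_1 ⊕ ⋯ ⊕ V_k`, in which the linear coordinates of `V_i` have
weight `i`. -/
def split (V : Fin k → SmoothVectorBundle.{u, v} M) : FilteredBundle.{u} k M where
  rank i := (V i).rank
  total := coreManifold (splitCore V) (isSmoothCore_splitCore V)
  proj := (splitCore V).proj
  atlas := Set.range (splitCore V).localTriv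
  exists_mem_baseSet x := ⟨_, ⟨x, rfl⟩, (splitCore V).mem_baseSet_at x⟩
  isSmooth := by
    rintro _ ⟨a, rfl⟩
    exact isSmoothTrivialization_localTriv _ _ a
  isFiltered := by
    rintro _ ⟨a, rfl⟩ _ ⟨b, rfl⟩
    obtain ⟨P, h1, h2⟩ := isWeightedPolynomial_splitCoordChange V a b
    refine ⟨P, h1, fun x hx s => ⟨(h2 x hx s).1, fun y => ?_⟩⟩
    rw [← (h2 x hx s).2 y]
    exact congrFun ((splitCore V).coordChange_comp a x b x
      ⟨⟨hx.1, (splitCore V).mem_baseSet_at x⟩, hx.2⟩ y) s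

end FilteredBundle

/-- The affine tower `T` is isomorphic, over the identity of the base, to the tower of the
filtered bundle `F`. -/
def AffineTower.IsTowerOf {k : ℕ} (T : AffineTower.{u} k) (F : FilteredBundle.{u} k T.base) :
    Prop :=
  ∃ φ : T.Iso F.tower, ∀ x : T.base, F.truncBase 0 (φ.toDiffeomorph 0 x) = x

/-- An affine tower is filterable if it is isomorphic to the tower of a filtered bundle. -/
def AffineTower.IsFilterable {k : ℕ} (T : AffineTower.{u} k) : Prop :=
  ∃ F : FilteredBundle.{u} k T.base, T.IsTowerOf F

/-- `v(B_i) ≅ (τ^{i-1}_0)^* V_i` for all `i`, as vector bundles over `B_{i-1}`. -/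
def AffineTower.IsModeledOn {k : ℕ} (T : AffineTower.{u} k)
    (V : Fin k → SmoothVectorBundle.{u, v} T.base) : Prop :=
  ∀ i : Fin k, Nonempty ((T.bundle i).model.Iso ((V i).pullback (T.toBase i.castSucc)))

end

noncomputable section

/-! ### Weighted polynomials with smooth coefficients -/

section WeightedPolynomial

variable {M : SmoothManifold.{u}} {k k' k'' : ℕ} {d : Fin k → ℕ} {d' : Fin k' → ℕ}
  {d'' : Fin k'' → ℕ}

/-! Everything follows from a splitting theorem: a filtered bundle is isomorphic to the sum of its
graded vector bundles, and these are determined by the tower.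

Graded bundles. All weights are positive, so in a polynomial of weighted degree `≤ w` a coordinate
of weight `w` can only occur alone and to the first power, with a coefficient depending on the base
point only (`exists_linear_monomial`, `IsWeightedPolynomial.exists_linear_block`). Hence the top
weight parts of the transition functions form linear cocycles over `M`, one for each weight
(`gradedCore`).

Splitting (`FilteredBundle.nonempty_iso_split`). A single chart gives a local filtered map into the
sum of the graded bundles by sending each block of coordinates linearly to its bundle. The target
has linear fibres, so these local maps can be averaged with a partition of unity; multiplying by
functions on the base does not raise degrees. On two points with the same lower coordinates, the top
weight differences produced by all charts agree, so the average is triangular with the same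
invertible diagonal blocks. Such a map is inverted weight by weight, and the inverse is again a
weighted polynomial (`IsWeightedPolynomial.exists_inverse`).

From the tower to the graded bundles. An isomorphism of towers is only affine along each step and
may be wild in the lower coordinates. Its linear part along the step `B_i → B_{i-1}` nevertheless
identifies the model bundle with the pull-back to `B_{i-1}` of the graded bundle of weight `i`; this
gives (2). By the splitting, a filtered bundle has a smooth section, hence so does each `B_{i-1} →
M`. Restricting an isomorphism of pull-backs to that section gives (4). Any `V_i` as in (2) is
therefore isomorphic to the graded bundle of any filtered bundle with the given tower, and the
splitting gives (3). For (1), two filtered bundles are compared with one common split bundle. -/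

theorem weightedTotalDegree_le_iff {p : MvPolynomial (Coord d) ℝ} {n : ℕ} :
    p.weightedTotalDegree Coord.weight ≤ n ↔
      ∀ m, n < Finsupp.weight Coord.weight m → p.coeff m = 0 := by
  constructor
  · intro h m hm
    by_contra hne
    exact absurd (FilteredBundle.weight_le_of_mem_support h (MvPolynomial.mem_support_iff.2 hne))
      (not_le.2 hm)
  · intro h
    refine Finset.sup_le fun m hm => ?_
    by_contra hne
    exact MvPolynomial.mem_support_iff.1 hm (h m (not_le.1 hne))

/-- A real function of a point of `U ⊆ M` and of the fibre coordinates which is a polynomial of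
weighted degree `≤ n` with coefficients smooth on `U`. -/
def IsSmoothWeightedFun (U : Set M) (n : ℕ) (f : M → (Coord d → ℝ) → ℝ) : Prop :=
  ∃ p : M → MvPolynomial (Coord d) ℝ,
    (∀ m, ContMDiffOn M.I 𝓘(ℝ) ∞ (fun x => (p x).coeff m) U) ∧
    ∀ x ∈ U, (p x).weightedTotalDegree Coord.weight ≤ n ∧ ∀ y, f x y = MvPolynomial.eval y (p x)

/-- Closure properties can then be proved for one real component at a time, with a degree bound not
tied to the weight of a coordinate. -/
theorem isWeightedPolynomial_iff {U : Set M} {g : M → (Coord d → ℝ) → (Coord d' → ℝ)} :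
    IsWeightedPolynomial M U g ↔
      ∀ s, IsSmoothWeightedFun U s.weight (fun x y => g x y s) := by
  constructor
  · rintro ⟨P, h1, h2⟩ s
    exact ⟨fun x => P x s, h1 s, fun x hx => h2 x hx s⟩
  · intro h
    choose P h1 h2 using h
    exact ⟨fun x s => P s x, h1, fun x hx s => h2 s x hx⟩

namespace IsSmoothWeightedFun

variable {U U' : Set M} {n n' : ℕ} {f f' : M → (Coord d → ℝ) → ℝ}

theorem congr (h : IsSmoothWeightedFun U n f) (hf : ∀ x ∈ U, ∀ y, f' x y = f x y) :
    IsSmoothWeightedFun U n f' := by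
  obtain ⟨p, h1, h2⟩ := h
  exact ⟨p, h1, fun x hx => ⟨(h2 x hx).1, fun y => (hf x hx y).trans ((h2 x hx).2 y)⟩⟩

theorem mono (h : IsSmoothWeightedFun U n f) (hU : U' ⊆ U) (hn : n ≤ n') :
    IsSmoothWeightedFun U' n' f := by
  obtain ⟨p, h1, h2⟩ := h
  exact ⟨p, fun m => (h1 m).mono hU, fun x hx => ⟨(h2 x (hU hx)).1.trans hn, (h2 x (hU hx)).2⟩⟩

theorem of_contMDiffOn {a : M → ℝ} (ha : ContMDiffOn M.I 𝓘(ℝ) ∞ a U) :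
    IsSmoothWeightedFun (d := d) U n (fun x _ => a x) := by
  classical
  refine ⟨fun x => MvPolynomial.C (a x), fun m => ?_, fun x _ => ⟨?_, fun y => by simp⟩⟩
  · simp only [MvPolynomial.coeff_C]
    by_cases h : 0 = m
    · simpa [h] using ha
    · simpa [h] using contMDiffOn_const
  · rw [weightedTotalDegree_le_iff]
    intro m hm
    rw [MvPolynomial.coeff_C, if_neg]
    rintro rfl
    simp at hm

theorem coord (s : Coord d) (hs : s.weight ≤ n) :
    IsSmoothWeightedFun (M := M) U n (fun _ (y : Coord d → ℝ) => y s) := by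
  classical
  refine ⟨fun x => MvPolynomial.X s, fun m => contMDiffOn_const, fun x _ => ⟨?_, fun y => by simp⟩⟩
  rw [weightedTotalDegree_le_iff]
  intro m hm
  rw [MvPolynomial.coeff_X, if_neg]
  rintro rfl
  rw [Finsupp.weight_single, one_smul] at hm
  exact absurd hs (not_le.2 hm)

theorem add (h : IsSmoothWeightedFun U n f) (h' : IsSmoothWeightedFun U n f') :
    IsSmoothWeightedFun U n (fun x y => f x y + f' x y) := by
  obtain ⟨p, h1, h2⟩ := h
  obtain ⟨p', h1', h2'⟩ := h'
  refine ⟨fun x => p x + p' x, fun m => ?_, fun x hx => ⟨?_, fun y => ?_⟩⟩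
  · simp only [MvPolynomial.coeff_add]
    exact (h1 m).add (h1' m)
  · rw [weightedTotalDegree_le_iff]
    intro m hm
    rw [MvPolynomial.coeff_add, weightedTotalDegree_le_iff.1 (h2 x hx).1 m hm,
      weightedTotalDegree_le_iff.1 (h2' x hx).1 m hm, add_zero]
  · simp only [(h2 x hx).2, (h2' x hx).2, map_add]

theorem mul (h : IsSmoothWeightedFun U n f) (h' : IsSmoothWeightedFun U n' f') :
    IsSmoothWeightedFun U (n + n') (fun x y => f x y * f' x y) := by
  classical
  obtain ⟨p, h1, h2⟩ := h
  obtain ⟨p', h1', h2'⟩ := h'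
  refine ⟨fun x => p x * p' x, fun m => ?_, fun x hx => ⟨?_, fun y => ?_⟩⟩
  · simp only [MvPolynomial.coeff_mul]
    exact contMDiffOn_finsetSum fun q _ => (h1 q.1).mul (h1' q.2)
  · rw [weightedTotalDegree_le_iff]
    intro m hm
    rw [MvPolynomial.coeff_mul]
    refine Finset.sum_eq_zero fun q hq => ?_
    rw [← Finset.HasAntidiagonal.mem_antidiagonal.1 hq, map_add] at hm
    -- The weight of the product exceeds `n + n'`, so one of the two factors exceeds its own bound.
    by_cases hq1 : n < Finsupp.weight Coord.weight q.1
    · rw [weightedTotalDegree_le_iff.1 (h2 x hx).1 _ hq1, zero_mul]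
    · rw [weightedTotalDegree_le_iff.1 (h2' x hx).1 q.2 (by omega), mul_zero]
  · simp only [(h2 x hx).2, (h2' x hx).2, map_mul]

theorem smul {a : M → ℝ} (ha : ContMDiffOn M.I 𝓘(ℝ) ∞ a U) (h : IsSmoothWeightedFun U n f) :
    IsSmoothWeightedFun U n (fun x y => a x * f x y) :=
  ((of_contMDiffOn (n := 0) ha).mul h).mono subset_rfl (zero_add n).le

theorem sum {ι : Type*} {S : Finset ι} {f : ι → M → (Coord d → ℝ) → ℝ}
    (h : ∀ i ∈ S, IsSmoothWeightedFun U n (f i)) :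
    IsSmoothWeightedFun U n (fun x y => ∑ i ∈ S, f i x y) := by
  classical
  induction S using Finset.induction_on with
  | empty => simpa using of_contMDiffOn (contMDiffOn_const (c := (0 : ℝ)))
  | insert i S hi ih =>
    simp only [Finset.sum_insert hi]
    exact (h i (Finset.mem_insert_self i S)).add
      (ih fun j hj => h j (Finset.mem_insert_of_mem hj))

theorem pow (h : IsSmoothWeightedFun U n f) (r : ℕ) :
    IsSmoothWeightedFun U (r * n) (fun x y => f x y ^ r) := by
  induction r with
  | zero => simpa using of_contMDiffOn (contMDiffOn_const (c := (1 : ℝ)))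
  | succ r ih =>
    simp only [pow_succ]
    exact (ih.mul h).mono subset_rfl (by rw [Nat.succ_mul])

theorem prod {ι : Type*} {S : Finset ι} {f : ι → M → (Coord d → ℝ) → ℝ} {n : ι → ℕ}
    (h : ∀ i ∈ S, IsSmoothWeightedFun U (n i) (f i)) :
    IsSmoothWeightedFun U (∑ i ∈ S, n i) (fun x y => ∏ i ∈ S, f i x y) := by
  classical
  induction S using Finset.induction_on with
  | empty => simpa using of_contMDiffOn (contMDiffOn_const (c := (1 : ℝ)))
  | insert i S hi ih =>
    simp only [Finset.prod_insert hi, Finset.sum_insert hi]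
    exact (h i (Finset.mem_insert_self i S)).mul
      (ih fun j hj => h j (Finset.mem_insert_of_mem hj))

/-- A polynomial of weighted degree `≤ n` is a linear combination of the finitely many monomials
of weight `≤ n`. -/
theorem exists_monomials (h : IsSmoothWeightedFun U n f) :
    ∃ (S : Finset (Coord d →₀ ℕ)) (a : (Coord d →₀ ℕ) → M → ℝ),
      (∀ m ∈ S, Finsupp.weight Coord.weight m ≤ n) ∧ (∀ m, ContMDiffOn M.I 𝓘(ℝ) ∞ (a m) U) ∧
      ∀ x ∈ U, ∀ y, f x y = ∑ m ∈ S, a m x * ∏ s ∈ m.support, y s ^ m s := by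
  obtain ⟨p, h1, h2⟩ := h
  -- Positive weights leave finitely many exponents of weight `≤ n`. This finite set does not depend
  -- on `x`, whereas the support of `p x` does.
  have hfin := Finsupp.finite_of_nat_weight_le (Coord.weight (d := d))
    (fun s => Nat.succ_ne_zero _) n
  refine ⟨hfin.toFinset, fun m x => (p x).coeff m, fun m hm => by simpa using hm, h1,
    fun x hx y => ?_⟩
  rw [(h2 x hx).2, MvPolynomial.eval_eq]
  refine Finset.sum_subset (fun m hm => ?_) (fun m _ hm => ?_)
  · simpa using FilteredBundle.weight_le_of_mem_support (h2 x hx).1 hm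
  · rw [MvPolynomial.notMem_support_iff.1 hm, zero_mul]

/-- The component of `g` at `s` has degree at most the weight of `s`, so substitution into a
monomial `m` yields degree at most the weight of `m`. -/
theorem comp {g : M → (Coord d' → ℝ) → (Coord d → ℝ)} (h : IsSmoothWeightedFun U n f)
    (hg : IsWeightedPolynomial M U g) : IsSmoothWeightedFun U n (fun x y => f x (g x y)) := by
  obtain ⟨S, a, hS, ha, hf⟩ := h.exists_monomials
  rw [isWeightedPolynomial_iff] at hg
  refine congr (sum (S := S) fun m hm => ?_) fun x hx y => hf x hx (g x y)
  refine (smul (ha m) (prod fun s _ => (hg s).pow (m s))).mono subset_rfl ?_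
  simpa [Finsupp.weight_apply, Finsupp.sum] using hS m hm

theorem contMDiffOn (h : IsSmoothWeightedFun U n f) :
    ContMDiffOn (M.I.prod 𝓘(ℝ, Coord d → ℝ)) 𝓘(ℝ) ∞
      (fun p : M × (Coord d → ℝ) => f p.1 p.2) (U ×ˢ univ) := by
  obtain ⟨S, a, -, ha, hf⟩ := h.exists_monomials
  refine ContMDiffOn.congr (f := fun p : M × (Coord d → ℝ) =>
    ∑ m ∈ S, a m p.1 * ∏ s ∈ m.support, p.2 s ^ m s) ?_ fun p hp => hf p.1 hp.1 p.2
  refine contMDiffOn_finsetSum fun m _ => ?_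
  refine ((ha m).comp contMDiffOn_fst fun p hp => hp.1).mul ?_
  have : ContDiff ℝ ∞ fun y : Coord d → ℝ => ∏ s ∈ m.support, y s ^ m s :=
    contDiff_prod fun s _ => (contDiff_apply ℝ ℝ s).pow _
  exact this.contMDiff.comp_contMDiffOn contMDiffOn_snd

/-- The coefficients are determined by the function, so the property is local on the base. -/
theorem of_locally (h : ∀ x ∈ U, ∃ W ∈ 𝓝 x, IsSmoothWeightedFun (U ∩ W) n f) :
    IsSmoothWeightedFun U n f := by
  classical
  -- The polynomials are chosen point by point, with no regularity in `x`. Smoothness is recovered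
  -- by comparison with the local families, through uniqueness of the polynomial.
  have hex (x : M) : ∃ p : MvPolynomial (Coord d) ℝ, x ∈ U →
      p.weightedTotalDegree Coord.weight ≤ n ∧ ∀ y, f x y = MvPolynomial.eval y p := by
    by_cases hx : x ∈ U
    · obtain ⟨W, hW, p, -, hp⟩ := h x hx
      exact ⟨p x, fun _ => hp x ⟨hx, mem_of_mem_nhds hW⟩⟩
    · exact ⟨0, fun h => absurd h hx⟩
  choose p hp using hex
  refine ⟨p, fun m x hx => ?_, hp⟩
  obtain ⟨W, hW, q, hq1, hq2⟩ := h x hx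
  have hq : ∀ z ∈ U ∩ W, (p z).coeff m = (q z).coeff m := by
    intro z hz
    congr 1
    -- A polynomial over an infinite field is determined by its values.
    refine MvPolynomial.funext fun y => ?_
    rw [← (hp z hz.1).2, ← (hq2 z hz).2]
  have h1 := ((hq1 m).congr hq) x ⟨hx, mem_of_mem_nhds hW⟩
  exact h1.mono_of_mem_nhdsWithin (inter_mem_nhdsWithin U hW)

end IsSmoothWeightedFun

namespace IsWeightedPolynomial

variable {U U' : Set M} {g g' : M → (Coord d → ℝ) → (Coord d' → ℝ)}

theorem congr (h : IsWeightedPolynomial M U g) (hg : ∀ x ∈ U, ∀ y, g' x y = g x y) :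
    IsWeightedPolynomial M U g' := by
  rw [isWeightedPolynomial_iff] at h ⊢
  exact fun s => (h s).congr fun x hx y => congrFun (hg x hx y) s

theorem mono (h : IsWeightedPolynomial M U g) (hU : U' ⊆ U) : IsWeightedPolynomial M U' g := by
  rw [isWeightedPolynomial_iff] at h ⊢
  exact fun s => (h s).mono hU le_rfl

theorem comp {h : M → (Coord d' → ℝ) → (Coord d'' → ℝ)} (hh : IsWeightedPolynomial M U h)
    (hg : IsWeightedPolynomial M U g) : IsWeightedPolynomial M U (fun x y => h x (g x y)) := by
  rw [isWeightedPolynomial_iff] at hh ⊢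
  exact fun s => (hh s).comp hg

theorem of_locally (h : ∀ x ∈ U, ∃ W ∈ 𝓝 x, IsWeightedPolynomial M (U ∩ W) g) :
    IsWeightedPolynomial M U g := by
  rw [isWeightedPolynomial_iff]
  refine fun s => IsSmoothWeightedFun.of_locally fun x hx => ?_
  obtain ⟨W, hW, hg⟩ := h x hx
  exact ⟨W, hW, isWeightedPolynomial_iff.1 hg s⟩

theorem contMDiffOn (h : IsWeightedPolynomial M U g) :
    ContMDiffOn (M.I.prod 𝓘(ℝ, Coord d → ℝ)) 𝓘(ℝ, Coord d' → ℝ) ∞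
      (fun p : M × (Coord d → ℝ) => g p.1 p.2) (U ×ˢ univ) :=
  contMDiffOn_pi_space.2 fun s => (isWeightedPolynomial_iff.1 h s).contMDiffOn

/-- Components of weight `≤ l` only depend on coordinates of weight `≤ l`. -/
theorem truncate_congr (h : IsWeightedPolynomial M U g) {x : M} (hx : x ∈ U) {l : ℕ}
    {y z : Coord d → ℝ} (hyz : FilteredBundle.truncate l y = FilteredBundle.truncate l z) :
    FilteredBundle.truncate l (g x y) = FilteredBundle.truncate l (g x z) := by
  obtain ⟨P, -, hP⟩ := h
  ext s
  obtain ⟨h1, h2⟩ := hP x hx s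
  simp only [FilteredBundle.truncate, h2]
  exact FilteredBundle.eval_eq_of_truncate_eq h1 s.2 hyz

end IsWeightedPolynomial

/-! ### The linear part of highest weight -/

/-- The block of coordinates of weight `i + 1`. -/
def block (i : Fin k) (y : Coord d → ℝ) : Fin (d i) → ℝ := fun j => y ⟨i, j⟩

/-- The point with given coordinates of weight `i + 1`, all other coordinates being zero. -/
def blockEmbed (i : Fin k) (z : Fin (d i) → ℝ) : Coord d → ℝ :=
  fun s => (Pi.single i z : ∀ w, Fin (d w) → ℝ) s.1 s.2

theorem block_blockEmbed (i : Fin k) (z : Fin (d i) → ℝ) : block i (blockEmbed (d := d) i z) = z := by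
  ext j
  simp [block, blockEmbed]

theorem truncate_blockEmbed (i : Fin k) (z : Fin (d i) → ℝ) :
    FilteredBundle.truncate i.val (blockEmbed (d := d) i z) =
      FilteredBundle.truncate i.val 0 := by
  ext ⟨s, hs⟩
  have : s.1 ≠ i := by
    rintro rfl
    exact absurd hs (by simp [Coord.weight])
  simp [FilteredBundle.truncate, blockEmbed, this]

theorem truncate_succ_ext {i : Fin k} {y z : Coord d → ℝ}
    (h : FilteredBundle.truncate i.val y = FilteredBundle.truncate i.val z)
    (hi : block i y = block i z) :
    FilteredBundle.truncate (i.val + 1) y = FilteredBundle.truncate (i.val + 1) z := by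
  ext ⟨⟨w, j⟩, hs⟩
  by_cases hw : w = i
  · subst hw
    exact congrFun hi j
  · refine congrFun h ⟨⟨w, j⟩, ?_⟩
    have : w.val ≠ i.val := fun h' => hw (Fin.ext h')
    simp only [Coord.weight] at hs ⊢
    omega

/-- A coordinate of weight above `i` already exhausts the bound `i + 1`, and every further factor
has positive weight, so such a monomial is that coordinate alone. All other monomials involve only
weights `≤ i` and contribute no difference. One `L` serves all values of the lower coordinates. -/
theorem exists_linear_monomial {i : Fin k} {m : Coord d →₀ ℕ}
    (hm : Finsupp.weight Coord.weight m ≤ i.val + 1) :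
    ∃ L : (Fin (d i) → ℝ) →ₗ[ℝ] ℝ, ∀ y z : Coord d → ℝ,
      FilteredBundle.truncate i.val y = FilteredBundle.truncate i.val z →
      ∏ s ∈ m.support, y s ^ m s - ∏ s ∈ m.support, z s ^ m s = L (block i y - block i z) := by
  classical
  by_cases h : ∃ s, m s ≠ 0 ∧ i.val < s.weight
  · obtain ⟨s, hs, hn⟩ := h
    have h1 : Finsupp.single s 1 ≤ m := by
      rw [Finsupp.single_le_iff]
      exact Nat.one_le_iff_ne_zero.2 hs
    obtain ⟨r, rfl⟩ := exists_add_of_le h1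
    rw [map_add, Finsupp.weight_single, one_smul] at hm
    have hr : Finsupp.weight Coord.weight r = 0 := by omega
    have hsw : s.weight = i.val + 1 := by omega
    have hr0 : r = 0 := by
      ext t
      by_contra hne
      have := Finsupp.le_weight_of_ne_zero' Coord.weight hne
      have h2 : 0 < t.weight := Nat.succ_pos _
      omega
    subst hr0
    obtain ⟨w, j⟩ := s
    obtain rfl : w = i := by
      ext
      simpa [Coord.weight] using hsw
    refine ⟨LinearMap.proj j, fun y z _ => ?_⟩
    rw [add_zero, Finsupp.support_single _ one_ne_zero]
    simp [block]
  · push Not at h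
    refine ⟨0, fun y z hyz => ?_⟩
    rw [LinearMap.zero_apply, sub_eq_zero]
    refine Finset.prod_congr rfl fun s hs => ?_
    rw [show y s = z s from congrFun hyz ⟨s, h s (Finsupp.mem_support_iff.1 hs)⟩]

theorem exists_linear_eval {i : Fin k} {p : MvPolynomial (Coord d) ℝ}
    (hp : p.weightedTotalDegree Coord.weight ≤ i.val + 1) :
    ∃ L : (Fin (d i) → ℝ) →ₗ[ℝ] ℝ, ∀ y z : Coord d → ℝ,
      FilteredBundle.truncate i.val y = FilteredBundle.truncate i.val z →
      MvPolynomial.eval y p - MvPolynomial.eval z p = L (block i y - block i z) := by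
  have h (m : Coord d →₀ ℕ) : ∃ L : (Fin (d i) → ℝ) →ₗ[ℝ] ℝ, m ∈ p.support →
      ∀ y z : Coord d → ℝ, FilteredBundle.truncate i.val y = FilteredBundle.truncate i.val z →
      ∏ s ∈ m.support, y s ^ m s - ∏ s ∈ m.support, z s ^ m s = L (block i y - block i z) := by
    by_cases hm : m ∈ p.support
    · obtain ⟨L, hL⟩ :=
        exists_linear_monomial (FilteredBundle.weight_le_of_mem_support hp hm)
      exact ⟨L, fun _ => hL⟩
    · exact ⟨0, fun h => absurd h hm⟩
  choose L hL using h
  refine ⟨∑ m ∈ p.support, p.coeff m • L m, fun y z hyz => ?_⟩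
  rw [MvPolynomial.eval_eq, MvPolynomial.eval_eq, ← Finset.sum_sub_distrib, LinearMap.sum_apply]
  refine Finset.sum_congr rfl fun m hm => ?_
  rw [← mul_sub, hL m hm y z hyz, LinearMap.smul_apply, smul_eq_mul]

/-- The quantifier order is the point: `L` depends on the base point, not on the lower coordinates.
This is what makes the graded bundles live over the base and not merely over the previous level of
the tower. -/
theorem IsWeightedPolynomial.exists_linear_block {U : Set M}
    {g : M → (Coord d → ℝ) → (Coord d' → ℝ)} (h : IsWeightedPolynomial M U g) {x : M} (hx : x ∈ U)
    (i : Fin k) (i' : Fin k') (hi : i'.val = i.val) :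
    ∃ L : (Fin (d i) → ℝ) →ₗ[ℝ] (Fin (d' i') → ℝ), ∀ y z : Coord d → ℝ,
      FilteredBundle.truncate i.val y = FilteredBundle.truncate i.val z →
      block i' (g x y) - block i' (g x z) = L (block i y - block i z) := by
  obtain ⟨P, -, hP⟩ := h
  have h1 (j : Fin (d' i')) := exists_linear_eval (i := i) (p := P x ⟨i', j⟩)
    ((hP x hx ⟨i', j⟩).1.trans (by simp [Coord.weight, hi]))
  choose L hL using h1
  refine ⟨LinearMap.pi L, fun y z hyz => funext fun j => ?_⟩
  rw [LinearMap.pi_apply, ← hL j y z hyz, ← (hP x hx ⟨i', j⟩).2, ← (hP x hx ⟨i', j⟩).2]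
  rfl

end WeightedPolynomial

/-! ### Isomorphisms of vector bundles -/

/-- The pointwise inverse of a smooth family of linear isomorphisms is smooth. -/
theorem exists_contMDiffOn_inverse {N : SmoothManifold.{u}} {E E' : Type*} [NormedAddCommGroup E]
    [NormedSpace ℝ E] [FiniteDimensional ℝ E] [NormedAddCommGroup E'] [NormedSpace ℝ E']
    [FiniteDimensional ℝ E'] {U : Set N} {T : N → E →ₗ[ℝ] E'}
    (hT : ∀ v, ContMDiffOn N.I 𝓘(ℝ, E') ∞ (fun x => T x v) U) (hb : ∀ x ∈ U, Bijective (T x)) :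
    ∃ S : N → E' →ₗ[ℝ] E, (∀ w, ContMDiffOn N.I 𝓘(ℝ, E) ∞ (fun x => S x w) U) ∧
      ∀ x ∈ U, (∀ v, S x (T x v) = v) ∧ ∀ w, T x (S x w) = w := by
  let c (x : N) : E →L[ℝ] E' := LinearMap.toContinuousLinearMap (T x)
  -- In finite dimension, smoothness on the vectors of a basis gives smoothness as a map into the
  -- normed space of operators.
  have hc : ContMDiffOn N.I 𝓘(ℝ, E →L[ℝ] E') ∞ c U := by
    let b := Module.finBasis ℝ E
    have hcb (x : N) : c x = ∑ j, (LinearMap.toContinuousLinearMap (b.coord j)).smulRight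
        (T x (b j)) := by
      ext v
      simp only [sum_apply, ContinuousLinearMap.smulRight_apply]
      conv_lhs => rw [← b.sum_repr v, map_sum]
      simp [c]
    refine ContMDiffOn.congr ?_ fun x _ => hcb x
    refine contMDiffOn_finsetSum fun j _ => ?_
    exact ((ContinuousLinearMap.smulRightL ℝ E E'
      (LinearMap.toContinuousLinearMap (b.coord j))).contMDiff).comp_contMDiffOn (hT (b j))
  have he (x : N) (hx : x ∈ U) : ∃ e : E ≃L[ℝ] E', (e : E →L[ℝ] E') = c x :=
    ⟨(LinearEquiv.ofBijective (T x) (hb x hx)).toContinuousLinearEquiv, by ext v; rfl⟩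
  -- `ContinuousLinearMap.inverse` is total, with value zero at non-invertible maps, and it is
  -- smooth at each invertible one.
  refine ⟨fun x => ((c x).inverse : E' →ₗ[ℝ] E), fun w x hx => ?_, fun x hx => ?_⟩
  · obtain ⟨e, he⟩ := he x hx
    have h1 : ContDiffAt ℝ ∞ (fun a : E →L[ℝ] E' => a.inverse w) (c x) := by
      rw [← he]
      exact (contDiffAt_map_inverse e).clm_apply contDiffAt_const
    exact h1.contMDiffAt.comp_contMDiffWithinAt x (hc x hx)
  · obtain ⟨e, he⟩ := he x hx
    have hT' (v : E) : T x v = e v := congrArg (fun a : E →L[ℝ] E' => a v) he.symm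
    simp only [ContinuousLinearMap.coe_coe, ← he, ContinuousLinearMap.inverse_equiv, hT']
    exact ⟨fun v => e.symm_apply_apply v, fun w => e.apply_symm_apply w⟩

/-- A family of linear maps that is pointwise smooth is jointly smooth. -/
theorem contMDiffOn_uncurry_linear {N : SmoothManifold.{u}} {E E' : Type*}
    [NormedAddCommGroup E] [NormedSpace ℝ E] [FiniteDimensional ℝ E] [NormedAddCommGroup E']
    [NormedSpace ℝ E'] {U : Set N} {T : N → E →ₗ[ℝ] E'}
    (hT : ∀ v, ContMDiffOn N.I 𝓘(ℝ, E') ∞ (fun x => T x v) U) :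
    ContMDiffOn (N.I.prod 𝓘(ℝ, E)) 𝓘(ℝ, E') ∞ (fun p : N × E => T p.1 p.2) (U ×ˢ univ) := by
  let b := Module.finBasis ℝ E
  refine ContMDiffOn.congr (f := fun p : N × E => ∑ j, b.coord j p.2 • T p.1 (b j)) ?_ ?_
  · refine contMDiffOn_finsetSum fun j _ => ?_
    have h1 : ContMDiffOn (N.I.prod 𝓘(ℝ, E)) 𝓘(ℝ) ∞ (fun p : N × E => b.coord j p.2)
        (U ×ˢ univ) :=
      ((LinearMap.toContinuousLinearMap (b.coord j)).contMDiff).comp_contMDiffOn contMDiffOn_snd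
    have h2 : ContMDiffOn (N.I.prod 𝓘(ℝ, E)) 𝓘(ℝ, E') ∞ (fun p : N × E => T p.1 (b j))
        (U ×ˢ univ) := (hT (b j)).comp contMDiffOn_fst fun p hp => hp.1
    exact h1.smul h2
  · intro p _
    conv_lhs => rw [← b.sum_repr p.2, map_sum]
    simp

namespace SmoothVectorBundle

variable {M N : SmoothManifold.{u}}

/-- A fibrewise linear map, given near each point by a smooth family in some pair of
trivializations, is smooth on the total spaces. -/
theorem contMDiff_of_local {V : SmoothVectorBundle.{u, v} M} {W : SmoothVectorBundle.{u, w} M}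
    (ψ : ∀ x, V.fiber x →ₗ[ℝ] W.fiber x)
    (h : ∀ x₀, ∃ (e : Trivialization (Fin V.rank → ℝ) (TotalSpace.proj : V.Total → M))
      (e' : Trivialization (Fin W.rank → ℝ) (TotalSpace.proj : W.Total → M))
      (_ : MemTrivializationAtlas e) (_ : MemTrivializationAtlas e'),
      x₀ ∈ e.baseSet ∩ e'.baseSet ∧
      ∃ T : M → (Fin V.rank → ℝ) →ₗ[ℝ] (Fin W.rank → ℝ),
        (∀ v, ContMDiffOn M.I 𝓘(ℝ, Fin W.rank → ℝ) ∞ (fun x => T x v)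
          (e.baseSet ∩ e'.baseSet)) ∧
        ∀ x ∈ e.baseSet ∩ e'.baseSet, ∀ a, (e' ⟨x, ψ x a⟩).2 = T x (e ⟨x, a⟩).2) :
    ContMDiff (M.I.prod 𝓘(ℝ, Fin V.rank → ℝ)) (M.I.prod 𝓘(ℝ, Fin W.rank → ℝ)) ∞
      (fun p : V.Total => (⟨p.proj, ψ p.proj p.snd⟩ : W.Total)) := by
  intro p
  obtain ⟨e, e', _, _, hx, T, hT, hψ⟩ := h p.proj
  have hp : (⟨p.proj, ψ p.proj p.snd⟩ : W.Total) ∈ e'.source := e'.mem_source.2 hx.2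
  refine (e'.contMDiffAt_iff (f := fun p : V.Total => (⟨p.proj, ψ p.proj p.snd⟩ : W.Total))
    hp).2 ⟨contMDiffAt_proj V.fiber, ?_⟩
  have hU : TotalSpace.proj ⁻¹' (e.baseSet ∩ e'.baseSet) ∈ 𝓝 p :=
    (e.open_baseSet.inter e'.open_baseSet).preimage
      (FiberBundle.continuous_proj (Fin V.rank → ℝ) V.fiber) |>.mem_nhds hx
  have h1 : ContMDiffAt (M.I.prod 𝓘(ℝ, Fin V.rank → ℝ)) (M.I.prod 𝓘(ℝ, Fin V.rank → ℝ)) ∞ e p :=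
    (e.contMDiffOn (n := ∞) (IB := M.I)).contMDiffAt (e.open_source.mem_nhds (e.mem_source.2 hx.1))
  have h2 := (contMDiffOn_uncurry_linear hT).contMDiffAt (x := e p)
    (((e.open_baseSet.inter e'.open_baseSet).prod isOpen_univ).mem_nhds
      ⟨by rw [e.coe_fst (e.mem_source.2 hx.1)]; exact hx, mem_univ _⟩)
  refine (h2.comp p h1).congr_of_eventuallyEq ?_
  filter_upwards [hU] with q hq
  rw [hψ q.proj hq q.snd, Function.comp_apply, e.coe_fst (e.mem_source.2 hq.1)]

/-- In trivializations, a smooth fibrewise linear map is given by a smooth family of linear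
maps. -/
theorem contMDiffOn_local {V : SmoothVectorBundle.{u, v} M} {W : SmoothVectorBundle.{u, w} M}
    {ψ : ∀ x, V.fiber x →ₗ[ℝ] W.fiber x}
    (h : ContMDiff (M.I.prod 𝓘(ℝ, Fin V.rank → ℝ)) (M.I.prod 𝓘(ℝ, Fin W.rank → ℝ)) ∞
      (fun p : V.Total => (⟨p.proj, ψ p.proj p.snd⟩ : W.Total)))
    (e : Trivialization (Fin V.rank → ℝ) (TotalSpace.proj : V.Total → M))
    (e' : Trivialization (Fin W.rank → ℝ) (TotalSpace.proj : W.Total → M))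
    [MemTrivializationAtlas e] [MemTrivializationAtlas e'] (a : Fin V.rank → ℝ) :
    ContMDiffOn M.I 𝓘(ℝ, Fin W.rank → ℝ) ∞
      (fun x => e'.linearMapAt ℝ x (ψ x (e.symmₗ ℝ x a))) (e.baseSet ∩ e'.baseSet) := by
  have h1 : ContMDiffOn M.I (M.I.prod 𝓘(ℝ, Fin V.rank → ℝ)) ∞
      (fun x => e.toOpenPartialHomeomorph.symm (x, a)) (e.baseSet ∩ e'.baseSet) :=
    (e.contMDiffOn_symm (n := ∞) (IB := M.I)).comp (contMDiffOn_id.prodMk contMDiffOn_const)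
      fun x hx => e.mem_target.2 hx.1
  have h2 := h.comp_contMDiffOn h1
  rw [e'.contMDiffOn_iff] at h2
  · refine h2.2.congr fun x hx => ?_
    rw [e'.coe_linearMapAt_of_mem (R := ℝ) hx.2, e.symmₗ_apply hx.1]
    exact congrArg (fun q : V.Total => (e' ⟨q.proj, ψ q.proj q.snd⟩).2) (e.mk_symm hx.1 a)
  · intro x hx
    rw [e'.mem_source, Function.comp_apply]
    change (e.toOpenPartialHomeomorph.symm (x, a)).proj ∈ e'.baseSet
    rw [e.proj_symm_apply (e.mem_target.2 hx.1)]
    exact hx.2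

namespace Iso

variable {V : SmoothVectorBundle.{u, v} M} {W : SmoothVectorBundle.{u, w} M}

/-- A smooth family of linear isomorphisms is an isomorphism of vector bundles. -/
def ofContMDiff (ψ : ∀ x, V.fiber x ≃ₗ[ℝ] W.fiber x)
    (h : ContMDiff (M.I.prod 𝓘(ℝ, Fin V.rank → ℝ)) (M.I.prod 𝓘(ℝ, Fin W.rank → ℝ)) ∞
      (fun p : V.Total => (⟨p.proj, ψ p.proj p.snd⟩ : W.Total))) : V.Iso W where
  toLinearEquiv := ψ
  contMDiff := h
  contMDiff_symm := by
    refine contMDiff_of_local (fun x => ((ψ x).symm : W.fiber x →ₗ[ℝ] V.fiber x)) fun x₀ => ?_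
    let e := trivializationAt (Fin V.rank → ℝ) V.fiber x₀
    let e' := trivializationAt (Fin W.rank → ℝ) W.fiber x₀
    refine ⟨e', e, inferInstance, inferInstance, ⟨FiberBundle.mem_baseSet_trivializationAt' x₀,
      FiberBundle.mem_baseSet_trivializationAt' x₀⟩, ?_⟩
    have h1 := contMDiffOn_local (ψ := fun x => (ψ x : V.fiber x →ₗ[ℝ] W.fiber x)) h e e'
    obtain ⟨S, hS, hS'⟩ := exists_contMDiffOn_inverse (T := fun x => (e'.linearMapAt ℝ x).comp
      ((ψ x : V.fiber x →ₗ[ℝ] W.fiber x).comp (e.symmₗ ℝ x))) h1 (by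
        intro x hx
        have h2 : Bijective (e.symmₗ ℝ x) := bijective_iff_has_inverse.2
          ⟨e.linearMapAt ℝ x, e.linearMapAt_symmₗ hx.1, e.symmₗ_linearMapAt hx.1⟩
        have h3 : Bijective (e'.linearMapAt ℝ x) := by
          rw [e'.linearMapAt_def_of_mem hx.2]
          exact (e'.linearEquivAt ℝ x hx.2).bijective
        exact h3.comp ((ψ x).bijective.comp h2))
    refine ⟨S, fun v => (hS v).mono fun x hx => ⟨hx.2, hx.1⟩, fun x hx a => ?_⟩
    have h4 := (hS' x ⟨hx.2, hx.1⟩).1 (e ⟨x, (ψ x).symm a⟩).2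
    refine h4.symm.trans ?_
    congr 1
    have h5 := e.symmₗ_linearMapAt (R := ℝ) hx.2 ((ψ x).symm a)
    rw [e.coe_linearMapAt_of_mem (R := ℝ) hx.2] at h5
    rw [LinearMap.comp_apply, LinearMap.comp_apply, h5, e'.coe_linearMapAt_of_mem (R := ℝ) hx.1]
    simp

/-- The inverse of an isomorphism of vector bundles. -/
def symm (φ : V.Iso W) : W.Iso V where
  toLinearEquiv x := (φ.toLinearEquiv x).symm
  contMDiff := φ.contMDiff_symm
  contMDiff_symm := φ.contMDiff

/-- The composition of isomorphisms of vector bundles. -/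
def trans.{t} {V' : SmoothVectorBundle.{u, t} M} (φ : V.Iso W) (φ' : W.Iso V') : V.Iso V' where
  toLinearEquiv x := (φ.toLinearEquiv x).trans (φ'.toLinearEquiv x)
  contMDiff := φ'.contMDiff.comp φ.contMDiff
  contMDiff_symm := φ.contMDiff_symm.comp φ'.contMDiff_symm

/-- The identity isomorphism. -/
def refl (V : SmoothVectorBundle.{u, v} M) : V.Iso V where
  toLinearEquiv _ := LinearEquiv.refl ℝ _
  contMDiff := contMDiff_id
  contMDiff_symm := contMDiff_id

end Iso

theorem contMDiff_pullback_lift (V : SmoothVectorBundle.{u, v} M) (f : C^∞⟮N.I, N; M.I, M⟯) :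
    ContMDiff (N.I.prod 𝓘(ℝ, Fin (V.pullback f).rank → ℝ)) (M.I.prod 𝓘(ℝ, Fin V.rank → ℝ)) ∞
      (fun p : (V.pullback f).Total => (⟨f p.proj, p.snd⟩ : V.Total)) := by
  intro p
  rw [contMDiffAt_totalSpace]
  have h := contMDiffAt_id (I := N.I.prod 𝓘(ℝ, Fin (V.pullback f).rank → ℝ)) (n := ∞) (x := p)
  rw [contMDiffAt_totalSpace] at h
  exact ⟨f.contMDiff.contMDiffAt.comp p h.1, h.2⟩

theorem contMDiff_to_pullback (V : SmoothVectorBundle.{u, v} M)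
    (f : C^∞⟮N.I, N; M.I, M⟯) {E H X : Type*} [NormedAddCommGroup E] [NormedSpace ℝ E]
    [TopologicalSpace H] {I : ModelWithCorners ℝ E H} [TopologicalSpace X] [ChartedSpace H X]
    {g : X → (V.pullback f).Total} (h1 : ContMDiff I N.I ∞ fun x => (g x).proj)
    (h2 : ContMDiff I (M.I.prod 𝓘(ℝ, Fin V.rank → ℝ)) ∞
      fun x => (⟨f (g x).proj, (g x).snd⟩ : V.Total)) :
    ContMDiff I (N.I.prod 𝓘(ℝ, Fin (V.pullback f).rank → ℝ)) ∞ g := by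
  intro x
  have h3 := h2 x
  rw [contMDiffAt_totalSpace] at h3 ⊢
  exact ⟨h1 x, h3.2⟩

/-- Vector bundles whose pull-backs along a map with a smooth section are isomorphic are
isomorphic. -/
theorem Iso.descend {V : SmoothVectorBundle.{u, v} M} {W : SmoothVectorBundle.{u, w} M}
    {f : C^∞⟮N.I, N; M.I, M⟯} (φ : (V.pullback f).Iso (W.pullback f)) {s : M → N}
    (hs : ContMDiff M.I N.I ∞ s) (hfs : ∀ x, f (s x) = x) : Nonempty (V.Iso W) := by
  -- `f (s x) = x` is not definitional, so the isomorphism over `f (s x)` must be transported to the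
  -- fibre over `x`. The transport is recorded as equalities in the total spaces, where smoothness
  -- can be read off.
  have hex (x y : M) (h : y = x) (ψ : V.fiber y ≃ₗ[ℝ] W.fiber y) :
      ∃ ψ' : V.fiber x ≃ₗ[ℝ] W.fiber x, ∀ a : V.fiber x, ∃ b : V.fiber y,
        (⟨x, a⟩ : V.Total) = ⟨y, b⟩ ∧ (⟨x, ψ' a⟩ : W.Total) = ⟨y, ψ b⟩ := by
    subst h
    exact ⟨ψ, fun a => ⟨a, rfl, rfl⟩⟩
  choose ψ hψ using fun x => hex x (f (s x)) (hfs x) (φ.toLinearEquiv (s x))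
  choose b hb hb' using hψ
  refine ⟨Iso.ofContMDiff ψ ?_⟩
  -- The isomorphism is the composite `V → f^*V → f^*W → W`, whose first map `g` covers `s`.
  let g (p : V.Total) : (V.pullback f).Total := ⟨s p.proj, b p.proj p.snd⟩
  have hproj : ContMDiff (M.I.prod 𝓘(ℝ, Fin V.rank → ℝ)) N.I ∞ fun p : V.Total => s p.proj :=
    hs.comp (contMDiff_proj V.fiber)
  have hg : ContMDiff (M.I.prod 𝓘(ℝ, Fin V.rank → ℝ)) (N.I.prod 𝓘(ℝ, Fin (V.pullback f).rank → ℝ)) ∞ g := by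
    refine contMDiff_to_pullback V f hproj ?_
    have : (fun p : V.Total => (⟨f (g p).proj, (g p).snd⟩ : V.Total)) = id := by
      funext p
      exact (hb p.proj p.snd).symm
    rw [this]
    exact contMDiff_id
  have h := (contMDiff_pullback_lift W f).comp (φ.contMDiff.comp hg)
  convert h using 1
  funext p
  exact hb' p.proj p.snd

end SmoothVectorBundle

/-! ### The graded vector bundles of a filtered bundle -/

namespace FilteredBundle

variable {k : ℕ} {M : SmoothManifold.{u}} (F : FilteredBundle.{u} k M)

/-- The coefficients of the coordinates of weight `i + 1` in the transition functions of the
coordinates of weight `i + 1`. -/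
def gradedCoordChange (i : Fin k) (e e' : F.atlas) (x : M) :
    (Fin (F.rank i) → ℝ) →L[ℝ] (Fin (F.rank i) → ℝ) :=
  AffineBundle.linearPart fun z => block i (e.1.coordChange e'.1 x (blockEmbed i z))

/-- `gradedCoordChange` is computed at points whose other coordinates vanish. Since the top linear
part is independent of the lower coordinates, it governs differences over any fixed lower
coordinates. -/
theorem block_coordChange_sub (i : Fin k) {e e' : F.atlas} {x : M}
    (hx : x ∈ e.1.baseSet ∩ e'.1.baseSet) {y z : Coord F.rank → ℝ}
    (h : truncate i.val y = truncate i.val z) :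
    block i (e.1.coordChange e'.1 x y) - block i (e.1.coordChange e'.1 x z) =
      F.gradedCoordChange i e e' x (block i y - block i z) := by
  obtain ⟨L, hL⟩ := (F.isFiltered e e.2 e' e'.2).exists_linear_block hx i i rfl
  rw [hL y z h, gradedCoordChange, AffineBundle.linearPart_eq
    (L.toAffineMap + AffineMap.const ℝ _ (block i (e.1.coordChange e'.1 x 0)))]
  · simp
  · intro v
    have := hL (blockEmbed i v) 0 (truncate_blockEmbed i v)
    rw [sub_eq_iff_eq_add, block_blockEmbed] at this
    rw [this]
    simp [show block i (0 : Coord F.rank → ℝ) = 0 from rfl]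

theorem gradedCoordChange_apply (i : Fin k) {e e' : F.atlas} {x : M}
    (hx : x ∈ e.1.baseSet ∩ e'.1.baseSet) (v : Fin (F.rank i) → ℝ) :
    F.gradedCoordChange i e e' x v =
      block i (e.1.coordChange e'.1 x (blockEmbed i v)) - block i (e.1.coordChange e'.1 x 0) := by
  rw [F.block_coordChange_sub i hx (truncate_blockEmbed i v), block_blockEmbed,
    show block i (0 : Coord F.rank → ℝ) = 0 from rfl, sub_zero]

theorem contMDiffOn_gradedCoordChange (i : Fin k) (e e' : F.atlas) :
    ContMDiffOn M.I 𝓘(ℝ, (Fin (F.rank i) → ℝ) →L[ℝ] (Fin (F.rank i) → ℝ)) ∞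
      (F.gradedCoordChange i e e') (e.1.baseSet ∩ e'.1.baseSet) := by
  have hc := (F.isSmooth e e.2).contMDiffOn_coordChange (F.isSmooth e' e'.2)
  have h (z : Fin (F.rank i) → ℝ) : ContMDiffOn M.I 𝓘(ℝ, Fin (F.rank i) → ℝ) ∞
      (fun x => block i (e.1.coordChange e'.1 x (blockEmbed i z)))
      (e.1.baseSet ∩ e'.1.baseSet) := by
    have h1 := hc.comp (contMDiffOn_id.prodMk (contMDiffOn_const (c := blockEmbed i z)))
      (fun x hx => ⟨hx, mem_univ _⟩)
    exact contMDiffOn_pi_space.2 fun j => contMDiffOn_pi_space.1 h1 ⟨i, j⟩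
  unfold gradedCoordChange AffineBundle.linearPart
  refine contMDiffOn_finsetSum fun j _ => ?_
  exact (((ContinuousLinearMap.smulRightL ℝ (Fin (F.rank i) → ℝ) (Fin (F.rank i) → ℝ))
    (ContinuousLinearMap.proj j)).contMDiff).comp_contMDiffOn ((h _).sub (h 0))

/-- The cocycle of the graded vector bundle of weight `i + 1`. -/
def gradedCore (i : Fin k) : VectorBundleCore ℝ M (Fin (F.rank i) → ℝ) F.atlas where
  baseSet e := e.1.baseSet
  isOpen_baseSet e := e.1.open_baseSet
  indexAt x := ⟨(F.exists_mem_baseSet x).choose, (F.exists_mem_baseSet x).choose_spec.1⟩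
  mem_baseSet_at x := (F.exists_mem_baseSet x).choose_spec.2
  coordChange := F.gradedCoordChange i
  coordChange_self e x hx v := by
    rw [F.gradedCoordChange_apply i ⟨hx, hx⟩, e.1.coordChange_same_apply hx,
      e.1.coordChange_same_apply hx, block_blockEmbed]
    exact sub_zero v
  continuousOn_coordChange e e' := (F.contMDiffOn_gradedCoordChange i e e').continuousOn
  coordChange_comp e e' e'' x hx v := by
    -- The difference formula for `e'` and `e''` is applied to the images of `blockEmbed i v` and
    -- `0` under the first transition function. These still agree in weights `≤ i`, because high
    -- coordinates do not enter low components.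
    rw [F.gradedCoordChange_apply i hx.1, ← F.block_coordChange_sub i ⟨hx.1.2, hx.2⟩,
      e.1.coordChange_coordChange e'.1 e''.1 hx.1.1 hx.1.2,
      e.1.coordChange_coordChange e'.1 e''.1 hx.1.1 hx.1.2,
      F.gradedCoordChange_apply i ⟨hx.1.1, hx.2⟩]
    exact F.truncate_coordChange_congr e e' hx.1 (truncate_blockEmbed i v)

instance (i : Fin k) : (F.gradedCore i).IsContMDiff M.I ∞ := ⟨F.contMDiffOn_gradedCoordChange i⟩

/-- The vector bundle of weight `i + 1` associated with a filtered bundle. -/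
def graded (i : Fin k) : SmoothVectorBundle.{u, 0} M where
  rank := F.rank i
  fiber := (F.gradedCore i).Fiber

/-- Linear coordinates on vector bundles `V_1, …, V_k` induced by the charts of a filtered
bundle, compatible with the highest weight part of its transition functions. -/
structure Framing (V : Fin k → SmoothVectorBundle.{u, v} M) where
  toLinear : F.atlas → ∀ i x, (Fin (F.rank i) → ℝ) →ₗ[ℝ] (V i).fiber x
  compat : ∀ (e e' : F.atlas) (i : Fin k), ∀ x ∈ e.1.baseSet ∩ e'.1.baseSet, ∀ v,
    toLinear e' i x (F.gradedCoordChange i e e' x v) = toLinear e i x v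
  bijective : ∀ (e : F.atlas) (i : Fin k), ∀ x ∈ e.1.baseSet, Bijective (toLinear e i x)
  contMDiffOn : ∀ (e : F.atlas) (i : Fin k) (v : Fin (F.rank i) → ℝ),
    ContMDiffOn M.I (M.I.prod 𝓘(ℝ, Fin (V i).rank → ℝ)) ∞
      (fun x => (⟨x, toLinear e i x v⟩ : (V i).Total)) e.1.baseSet

/-- The framing given by isomorphisms with the graded vector bundles. -/
def Framing.ofIso {V : Fin k → SmoothVectorBundle.{u, v} M} (ψ : ∀ i, (F.graded i).Iso (V i)) :
    F.Framing V where
  -- The fibre over `x` is the model space read in the chart `indexAt x`, so coordinates in `e` are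
  -- first converted to that chart.
  toLinear e i x := ((ψ i).toLinearEquiv x : (F.graded i).fiber x →ₗ[ℝ] (V i).fiber x).comp
    (F.gradedCoordChange i e ((F.gradedCore i).indexAt x) x :
      (Fin (F.rank i) → ℝ) →ₗ[ℝ] (Fin (F.rank i) → ℝ))
  compat e e' i x hx v := by
    refine congrArg ((ψ i).toLinearEquiv x) ?_
    exact (F.gradedCore i).coordChange_comp e e' _ x ⟨hx, (F.gradedCore i).mem_baseSet_at x⟩ v
  bijective e i x hx := by
    refine ((ψ i).toLinearEquiv x).bijective.comp (bijective_iff_has_inverse.2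
      ⟨F.gradedCoordChange i ((F.gradedCore i).indexAt x) e x, fun v => ?_, fun v => ?_⟩)
    · refine ((F.gradedCore i).coordChange_comp e ((F.gradedCore i).indexAt x) e x
        ⟨⟨hx, (F.gradedCore i).mem_baseSet_at x⟩, hx⟩ v).trans ?_
      exact (F.gradedCore i).coordChange_self e x hx v
    · refine ((F.gradedCore i).coordChange_comp ((F.gradedCore i).indexAt x) e
        ((F.gradedCore i).indexAt x) x
        ⟨⟨(F.gradedCore i).mem_baseSet_at x, hx⟩, (F.gradedCore i).mem_baseSet_at x⟩ v).trans ?_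
      exact (F.gradedCore i).coordChange_self _ x ((F.gradedCore i).mem_baseSet_at x) v
  contMDiffOn e i v := by
    let t : Trivialization (Fin (F.graded i).rank → ℝ)
      (TotalSpace.proj : (F.graded i).Total → M) := (F.gradedCore i).localTriv e
    have ht : MemTrivializationAtlas t := ⟨⟨e, rfl⟩⟩
    have h1 : ContMDiffOn M.I (M.I.prod 𝓘(ℝ, Fin (F.graded i).rank → ℝ)) ∞
        (fun x => t.toOpenPartialHomeomorph.symm (x, v)) e.1.baseSet :=
      (t.contMDiffOn_symm (n := ∞) (IB := M.I)).comp (contMDiffOn_id.prodMk contMDiffOn_const)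
        fun x hx => t.mem_target.2 hx
    exact (ψ i).contMDiff.comp_contMDiffOn h1

end FilteredBundle

/-! ### Inverting triangular weighted polynomial maps -/

section Inverse

variable {M : SmoothManifold.{u}} {k : ℕ} {d d' : Fin k → ℕ} {U : Set M}

theorem IsSmoothWeightedFun.sub {n : ℕ} {f f' : M → (Coord d → ℝ) → ℝ}
    (h : IsSmoothWeightedFun U n f) (h' : IsSmoothWeightedFun U n f') :
    IsSmoothWeightedFun U n (fun x y => f x y - f' x y) :=
  (h.add (h'.smul (contMDiffOn_const (c := (-1 : ℝ))))).congr fun _ _ _ => by ring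

theorem IsSmoothWeightedFun.linear {n a b : ℕ} {T : M → (Fin a → ℝ) →ₗ[ℝ] (Fin b → ℝ)}
    (hT : ∀ v, ContMDiffOn M.I 𝓘(ℝ, Fin b → ℝ) ∞ (fun x => T x v) U)
    {f : M → (Coord d → ℝ) → Fin a → ℝ} (hf : ∀ l, IsSmoothWeightedFun U n (fun x y => f x y l))
    (j : Fin b) : IsSmoothWeightedFun U n (fun x y => T x (f x y) j) := by
  have h (l : Fin a) := (hf l).smul (contMDiffOn_pi_space.1 (hT (Pi.single l 1)) j)
  refine (IsSmoothWeightedFun.sum (S := Finset.univ) fun l _ => h l).congr fun x _ y => ?_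
  conv_lhs => rw [pi_eq_sum_univ' (f x y), map_sum]
  simp [Finset.sum_apply, mul_comm, Pi.single]

/-- In weight `i + 1`, `g` is `T i` applied to that block plus a function of the lower coordinates,
so `g x y = z` is solved one weight at a time: a solution up to weight `n` is corrected in weight `n
+ 1` by the inverse of `T` applied to the remaining error. The error is a composite of weighted
polynomials, so the correction has the required degree and smooth coefficients. -/
theorem IsWeightedPolynomial.exists_inverse {g : M → (Coord d → ℝ) → (Coord d' → ℝ)}
    (hg : IsWeightedPolynomial M U g) (T : ∀ i, M → (Fin (d i) → ℝ) →ₗ[ℝ] (Fin (d' i) → ℝ))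
    (hT : ∀ i v, ContMDiffOn M.I 𝓘(ℝ, Fin (d' i) → ℝ) ∞ (fun x => T i x v) U)
    (hb : ∀ i, ∀ x ∈ U, Bijective (T i x))
    (hgT : ∀ i, ∀ x ∈ U, ∀ y z : Coord d → ℝ,
      FilteredBundle.truncate i.val y = FilteredBundle.truncate i.val z →
      block i (g x y) - block i (g x z) = T i x (block i y - block i z)) :
    ∃ h : M → (Coord d' → ℝ) → (Coord d → ℝ), IsWeightedPolynomial M U h ∧
      ∀ x ∈ U, (∀ y, h x (g x y) = y) ∧ ∀ z, g x (h x z) = z := by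
  choose S hS hST using fun i => exists_contMDiffOn_inverse (hT i) (hb i)
  -- No weight exceeds `k`, so truncation at `k` forgets nothing.
  have htop {d : Fin k → ℕ} {y z : Coord d → ℝ}
      (h : FilteredBundle.truncate k y = FilteredBundle.truncate k z) : y = z :=
    funext fun s => congrFun h ⟨s, s.1.isLt⟩
  have key (n : ℕ) (hn : n ≤ k) : ∃ h : M → (Coord d' → ℝ) → (Coord d → ℝ),
      IsWeightedPolynomial M U h ∧ ∀ x ∈ U, ∀ z,
        FilteredBundle.truncate n (g x (h x z)) = FilteredBundle.truncate n z := by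
    induction n with
    | zero =>
      refine ⟨fun _ _ _ => 0, ?_, fun x _ z => ?_⟩
      · rw [isWeightedPolynomial_iff]
        exact fun s => IsSmoothWeightedFun.of_contMDiffOn contMDiffOn_const
      · ext s
        exact absurd s.2 (Nat.not_succ_le_zero _)
    | succ n ih =>
      obtain ⟨h, hh, hgh⟩ := ih (Nat.le_of_succ_le hn)
      -- Index `n` stands for weight `n + 1`, the first weight not yet solved.
      let i : Fin k := ⟨n, hn⟩
      refine ⟨fun x z => h x z + blockEmbed i (S i x (block i z - block i (g x (h x z)))),
        ?_, fun x hx z => ?_⟩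
      · have hc := isWeightedPolynomial_iff.1 (hg.comp hh)
        rw [isWeightedPolynomial_iff] at hh ⊢
        rintro ⟨w, j⟩
        refine (hh ⟨w, j⟩).add ?_
        by_cases hw : w = i
        · subst hw
          refine (IsSmoothWeightedFun.linear (hS i)
            (f := fun x z => block i z - block i (g x (h x z))) (fun l => ?_) j).congr
            fun x _ z => congrFun (block_blockEmbed i _) j
          exact (IsSmoothWeightedFun.coord ⟨i, l⟩ le_rfl).sub (hc ⟨i, l⟩)
        · refine (IsSmoothWeightedFun.of_contMDiffOn (contMDiffOn_const (c := (0 : ℝ)))).congr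
            fun x _ z => ?_
          simp [blockEmbed, hw]
      · have hlow : FilteredBundle.truncate i.val
            (h x z + blockEmbed i (S i x (block i z - block i (g x (h x z))))) =
            FilteredBundle.truncate i.val (h x z) := by
          ext s
          have := congrFun (truncate_blockEmbed i (S i x (block i z - block i (g x (h x z))))) s
          simp only [FilteredBundle.truncate, Pi.add_apply, Pi.zero_apply] at this ⊢
          rw [this, add_zero]
        refine truncate_succ_ext (i := i) ((hg.truncate_congr hx hlow).trans (hgh x hx z)) ?_
        have h1 := hgT i x hx _ _ hlow
        have h2 (a b : Coord d → ℝ) : block i (a + b) - block i a = block i b := by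
          ext j
          simp [block]
        rw [h2, block_blockEmbed, (hST i x hx).2] at h1
        exact sub_left_injective h1
  obtain ⟨h, hh, hgh⟩ := key k le_rfl
  have hgh' (x : M) (hx : x ∈ U) (z : Coord d' → ℝ) : g x (h x z) = z := htop (hgh x hx z)
  -- The construction gives a right inverse. Injectivity, by the same induction on weights, makes it
  -- two-sided.
  have hinj (x : M) (hx : x ∈ U) : Injective (g x) := by
    intro y z hyz
    have h1 (n : ℕ) (hn : n ≤ k) :
        FilteredBundle.truncate n y = FilteredBundle.truncate n z := by
      induction n with
      | zero =>
        ext s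
        exact absurd s.2 (Nat.not_succ_le_zero _)
      | succ n ih =>
        let i : Fin k := ⟨n, hn⟩
        refine truncate_succ_ext (i := i) (ih (Nat.le_of_succ_le hn)) ?_
        have h2 := hgT i x hx y z (ih (Nat.le_of_succ_le hn))
        rw [hyz, sub_self, eq_comm, map_eq_zero_iff _ (hb i x hx).1] at h2
        exact sub_eq_zero.1 h2
    exact htop (h1 k le_rfl)
  exact ⟨h, hh, fun x hx => ⟨fun y => hinj x hx (hgh' x hx _), hgh' x hx⟩⟩

end Inverse

/-! ### Isomorphisms of filtered bundles -/

namespace FilteredBundle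

variable {k : ℕ} {M : SmoothManifold.{u}} {F F' F'' : FilteredBundle.{u} k M}

/-- The local expression of a map in filtered charts. -/
def localRep (f : F.total → F'.total) (e : Trivialization (Coord F.rank → ℝ) F.proj)
    (e' : Trivialization (Coord F'.rank → ℝ) F'.proj) (x : M) (y : Coord F.rank → ℝ) :
    Coord F'.rank → ℝ :=
  (e' (f (e.toOpenPartialHomeomorph.symm (x, y)))).2

theorem apply_symm_eq {f : F.total → F'.total} (hf : ∀ p, F'.proj (f p) = F.proj p)
    {e : Trivialization (Coord F.rank → ℝ) F.proj}
    {e' : Trivialization (Coord F'.rank → ℝ) F'.proj} {x : M} (hx : x ∈ e.baseSet ∩ e'.baseSet)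
    (y : Coord F.rank → ℝ) :
    f (e.toOpenPartialHomeomorph.symm (x, y)) =
      e'.toOpenPartialHomeomorph.symm (x, localRep f e e' x y) := by
  have h1 : F'.proj (f (e.toOpenPartialHomeomorph.symm (x, y))) = x := by
    rw [hf, e.proj_symm_apply' hx.1]
  have h2 : f (e.toOpenPartialHomeomorph.symm (x, y)) ∈ e'.source :=
    e'.mem_source.2 (by rw [h1]; exact hx.2)
  rw [← e'.toOpenPartialHomeomorph.left_inv h2]
  congr 1
  exact Prod.ext ((e'.coe_fst h2).trans h1) rfl

theorem exists_eq_symm {e : Trivialization (Coord F.rank → ℝ) F.proj} {p : F.total}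
    (hp : F.proj p ∈ e.baseSet) :
    p = e.toOpenPartialHomeomorph.symm (F.proj p, (e p).2) := by
  have h := e.mem_source.2 hp
  conv_lhs => rw [← e.toOpenPartialHomeomorph.left_inv h]
  congr 1
  exact Prod.ext (e.coe_fst h) rfl

/-- Weighted polynomials with smooth coefficients are jointly smooth, so a candidate isomorphism
need only be shown to be filtered. -/
theorem IsFilteredMap.contMDiff {f : F.total → F'.total} (hf : IsFilteredMap F F' f) :
    ContMDiff F.total.I F'.total.I ∞ f := by
  intro p
  obtain ⟨e, he, hx⟩ := F.exists_mem_baseSet (F.proj p)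
  obtain ⟨e', he', hx'⟩ := F'.exists_mem_baseSet (F.proj p)
  have hs : e.source ∩ F.proj ⁻¹' e'.baseSet ∈ 𝓝 p := by
    have h1 : ContinuousAt F.proj p := e.continuousAt_proj (e.mem_source.2 hx)
    exact Filter.inter_mem (e.open_source.mem_nhds (e.mem_source.2 hx))
      (h1.preimage_mem_nhds (e'.open_baseSet.mem_nhds hx'))
  have h1 := (F.isSmooth e he).1.mono (t := e.source ∩ F.proj ⁻¹' e'.baseSet) inter_subset_left
  have h2 := (hf.2 e he e' he').contMDiffOn.comp h1 (fun q hq => ⟨⟨by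
    rw [e.coe_fst hq.1]; exact e.mem_source.1 hq.1, by rw [e.coe_fst hq.1]; exact hq.2⟩,
    mem_univ _⟩)
  have h3 := (F'.isSmooth e' he').2.comp ((contMDiff_fst.comp_contMDiffOn h1).prodMk h2)
    (fun q hq => e'.mem_target.2 (by
      change (e q).1 ∈ e'.baseSet
      rw [e.coe_fst hq.1]; exact hq.2))
  refine (h3.congr fun q hq => ?_).contMDiffAt hs
  have h4 := apply_symm_eq hf.1 (e := e) (e' := e') ⟨e.mem_source.1 hq.1, hq.2⟩ (e q).2
  rw [← exists_eq_symm (e.mem_source.1 hq.1)] at h4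
  rw [h4]
  simp only [Function.comp_apply, e.coe_fst hq.1]
  rfl

/-- A filtered map which is invertible in charts, with inverses given by weighted polynomials, is
an isomorphism. -/
theorem IsFilteredMap.nonempty_iso {f : F.total → F'.total} (hf : IsFilteredMap F F' f)
    (h : ∀ e ∈ F.atlas, ∀ e' ∈ F'.atlas,
      ∃ h : M → (Coord F'.rank → ℝ) → (Coord F.rank → ℝ),
        IsWeightedPolynomial M (e.baseSet ∩ e'.baseSet) h ∧ ∀ x ∈ e.baseSet ∩ e'.baseSet,
          (∀ y, h x (localRep f e e' x y) = y) ∧ ∀ z, localRep f e e' x (h x z) = z) :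
    Nonempty (F.Iso F') := by
  have hinj : Injective f := by
    intro p q hpq
    have hx : F.proj p = F.proj q := by rw [← hf.1, hpq, hf.1]
    obtain ⟨e, he, hxe⟩ := F.exists_mem_baseSet (F.proj p)
    obtain ⟨e', he', hxe'⟩ := F'.exists_mem_baseSet (F.proj p)
    obtain ⟨h, -, hh⟩ := h e he e' he'
    have hp := exists_eq_symm hxe
    have hq := exists_eq_symm (p := q) (e := e) (hx ▸ hxe)
    rw [← hx] at hq
    have h1 : localRep f e e' (F.proj p) (e p).2 = localRep f e e' (F.proj p) (e q).2 := by
      unfold localRep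
      rw [← hp, ← hq, hpq]
    have h2 := congrArg (h (F.proj p)) h1
    rw [(hh _ ⟨hxe, hxe'⟩).1, (hh _ ⟨hxe, hxe'⟩).1] at h2
    rw [hp, hq, h2]
  have hsurj : Surjective f := by
    intro q
    obtain ⟨e, he, hxe⟩ := F.exists_mem_baseSet (F'.proj q)
    obtain ⟨e', he', hxe'⟩ := F'.exists_mem_baseSet (F'.proj q)
    obtain ⟨h, -, hh⟩ := h e he e' he'
    refine ⟨e.toOpenPartialHomeomorph.symm (F'.proj q, h (F'.proj q) (e' q).2), ?_⟩
    rw [apply_symm_eq hf.1 ⟨hxe, hxe'⟩, (hh _ ⟨hxe, hxe'⟩).2, ← exists_eq_symm hxe']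
  let φ := Equiv.ofBijective f ⟨hinj, hsurj⟩
  have hsymm : IsFilteredMap F' F φ.symm := by
    have hproj (q : F'.total) : F.proj (φ.symm q) = F'.proj q := by
      rw [← hf.1]
      exact congrArg F'.proj (φ.apply_symm_apply q)
    refine ⟨hproj, fun e' he' e he => ?_⟩
    obtain ⟨h, hh, hh'⟩ := h e he e' he'
    refine (hh.mono fun x hx => ⟨hx.2, hx.1⟩).congr fun x hx z => ?_
    have h1 := apply_symm_eq hf.1 (e := e) (e' := e') ⟨hx.2, hx.1⟩ (h x z)
    rw [(hh' x ⟨hx.2, hx.1⟩).2] at h1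
    rw [← h1, show φ.symm (f (e.toOpenPartialHomeomorph.symm (x, h x z))) = _ from
      φ.symm_apply_apply _, e.apply_symm_apply' hx.2]
  exact ⟨⟨⟨φ, hf.contMDiff, hsymm.contMDiff⟩, hf, hsymm⟩⟩

/-- A single intermediate chart `e'` need not cover the whole overlap of `e` and `e''`. The
composite is visibly polynomial only near each point, and uniqueness of the coefficients patches
these expressions. -/
theorem IsFilteredMap.comp {f : F.total → F'.total} {f' : F'.total → F''.total}
    (hf' : IsFilteredMap F' F'' f') (hf : IsFilteredMap F F' f) :
    IsFilteredMap F F'' (f' ∘ f) := by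
  refine ⟨fun p => (hf'.1 _).trans (hf.1 p), fun e he e'' he'' => ?_⟩
  refine IsWeightedPolynomial.of_locally fun x hx => ?_
  obtain ⟨e', he', hx'⟩ := F'.exists_mem_baseSet x
  refine ⟨e'.baseSet, e'.open_baseSet.mem_nhds hx', ?_⟩
  have h1 := (hf.2 e he e' he').mono (U' := e.baseSet ∩ e''.baseSet ∩ e'.baseSet)
    fun z hz => ⟨hz.1.1, hz.2⟩
  have h2 := (hf'.2 e' he' e'' he'').mono (U' := e.baseSet ∩ e''.baseSet ∩ e'.baseSet)
    fun z hz => ⟨hz.2, hz.1.2⟩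
  refine (h2.comp h1).congr fun z hz y => ?_
  exact congrArg (fun q => (e'' (f' q)).2) (apply_symm_eq hf.1 ⟨hz.1.1, hz.2⟩ y)

/-- The inverse of an isomorphism of filtered bundles. -/
def Iso.symm (φ : F.Iso F') : F'.Iso F where
  toDiffeomorph := φ.toDiffeomorph.symm
  isFilteredMap := φ.isFilteredMap_symm
  isFilteredMap_symm := φ.isFilteredMap

/-- The composition of isomorphisms of filtered bundles. -/
def Iso.trans (φ : F.Iso F') (φ' : F'.Iso F'') : F.Iso F'' where
  toDiffeomorph := φ.toDiffeomorph.trans φ'.toDiffeomorph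
  isFilteredMap := φ'.isFilteredMap.comp φ.isFilteredMap
  isFilteredMap_symm := φ.isFilteredMap_symm.comp φ'.isFilteredMap_symm

/-! ### Splitting a filtered bundle -/

/-- The point of the Whitney sum with given components. -/
def splitMk (V : Fin k → SmoothVectorBundle.{u, v} M) (x : M) (a : ∀ i, (V i).fiber x) :
    (split V).total :=
  (⟨x, fun s => (trivializationAt (Fin (V s.1).rank → ℝ) (V s.1).fiber x ⟨x, a s.1⟩).2 s.2⟩ :
    TotalSpace _ (splitCore V).Fiber)

/-- The components are stored in the trivializations at `x`; the transition to those at `c` cancels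
this choice. -/
theorem block_splitMk (V : Fin k → SmoothVectorBundle.{u, v} M) {x c : M}
    (a : ∀ i, (V i).fiber x) (hx : x ∈ ((splitCore V).localTriv c).baseSet) (i : Fin k) :
    block i ((splitCore V).localTriv c (splitMk V x a)).2 =
      (trivializationAt (Fin (V i).rank → ℝ) (V i).fiber c).linearMapAt ℝ x (a i) := by
  have hc : x ∈ (trivializationAt (Fin (V i).rank → ℝ) (V i).fiber c).baseSet :=
    mem_iInter.1 hx i
  have hx' := FiberBundle.mem_baseSet_trivializationAt' (F := Fin (V i).rank → ℝ)
    (E := (V i).fiber) x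
  rw [Trivialization.coe_linearMapAt_of_mem _ hc]
  change (trivializationAt (Fin (V i).rank → ℝ) (V i).fiber x).coordChangeL ℝ
    (trivializationAt (Fin (V i).rank → ℝ) (V i).fiber c) x
    (trivializationAt (Fin (V i).rank → ℝ) (V i).fiber x ⟨x, a i⟩).2 = _
  rw [Trivialization.coordChangeL_apply _ _ ⟨hx', hc⟩, Trivialization.symm_apply_apply_mk _ hx']

/-- A filtered bundle is isomorphic to the sum of vector bundles isomorphic to its graded vector
bundles. -/
theorem nonempty_iso_split (F : FilteredBundle.{u} k M) {V : Fin k → SmoothVectorBundle.{u, v} M}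
    (θ : F.Framing V) : Nonempty (F.Iso (split V)) := by
  have : LocallyCompactSpace M := Manifold.locallyCompact_of_finiteDimensional M.I
  obtain ⟨ρ, hρ⟩ := SmoothPartitionOfUnity.exists_isSubordinate M.I isClosed_univ
    (fun e : F.atlas => e.1.baseSet) (fun e => e.1.open_baseSet) (fun x _ => by
      obtain ⟨e, he, hx⟩ := F.exists_mem_baseSet x
      exact mem_iUnion.2 ⟨⟨e, he⟩, hx⟩)
  let τ (c : M) (i : Fin k) := trivializationAt (Fin (V i).rank → ℝ) (V i).fiber c
  let T (a : F.atlas) (c : M) (i : Fin k) (x : M) :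
      (Fin (F.rank i) → ℝ) →ₗ[ℝ] (Fin (V i).rank → ℝ) :=
    ((τ c i).linearMapAt ℝ x).comp (θ.toLinear a i x)
  have hT (a : F.atlas) (c : M) (i : Fin k) (v : Fin (F.rank i) → ℝ) :
      ContMDiffOn M.I 𝓘(ℝ, Fin (V i).rank → ℝ) ∞ (fun x => T a c i x v)
        (a.1.baseSet ∩ ((splitCore V).localTriv c).baseSet) := by
    have h1 := (θ.contMDiffOn a i v).mono
      (t := a.1.baseSet ∩ ((splitCore V).localTriv c).baseSet) inter_subset_left
    rw [(τ c i).contMDiffOn_iff fun x hx => (τ c i).mem_source.2 (mem_iInter.1 hx.2 i)] at h1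
    refine h1.2.congr fun x hx => ?_
    exact congrFun ((τ c i).coe_linearMapAt_of_mem (R := ℝ) (mem_iInter.1 hx.2 i)) _
  -- Each chart sends its blocks to the `V i` through the framing, and these images are averaged in
  -- the vector space over the base point. Charts not containing that point have weight zero, so
  -- their junk values do not enter.
  let f (p : F.total) : (split V).total := splitMk V (F.proj p) fun i =>
    ∑ a ∈ ρ.finsupport (F.proj p), ρ a (F.proj p) • θ.toLinear a i (F.proj p) (block i (a.1 p).2)
  -- `finsupport` varies with `x`. Allowing any larger `S` makes it possible to keep the index set
  -- fixed near a point.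
  have hf (b : F.atlas) (c : M) (i : Fin k) {x : M}
      (hx : x ∈ b.1.baseSet ∩ ((splitCore V).localTriv c).baseSet) (y : Coord F.rank → ℝ)
      (S : Finset F.atlas) (hS : ρ.finsupport x ⊆ S) :
      block i (localRep (F' := split V) f b.1 ((splitCore V).localTriv c) x y) =
        ∑ a ∈ S, ρ a x • T a c i x (block i (b.1.coordChange a.1 x y)) := by
    have h1 : F.proj (b.1.toOpenPartialHomeomorph.symm (x, y)) = x := b.1.proj_symm_apply' hx.1
    refine (block_splitMk V _ (by rw [h1]; exact hx.2) i).trans ?_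
    rw [h1, map_sum]
    simp only [map_smul]
    refine Finset.sum_subset hS fun a _ ha => ?_
    rw [SmoothPartitionOfUnity.mem_finsupport, Function.notMem_support] at ha
    rw [ha, zero_smul]
  -- Near `x`, finitely many charts carry all the weight, and each of them contains the whole
  -- neighbourhood.
  have hloc (x : M) := ρ.toPartitionOfUnity.exists_finset_nhds_support_subset
    hρ.toPartitionOfUnity (fun e => e.1.open_baseSet) x
  have hfil : IsFilteredMap F (split V) f := by
    refine ⟨fun p => rfl, ?_⟩
    rintro b hb _ ⟨c, rfl⟩
    refine IsWeightedPolynomial.of_locally fun x hx => ?_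
    obtain ⟨S, W, hW, hWS, hρS⟩ := hloc x
    refine ⟨W, hW, ?_⟩
    rw [isWeightedPolynomial_iff]
    rintro ⟨i, j⟩
    have h1 (a : F.atlas) (ha : a ∈ S) : IsSmoothWeightedFun
        (b.baseSet ∩ ((splitCore V).localTriv c).baseSet ∩ W) (i.val + 1)
        (fun x y => ρ a x * T a c i x (block i (b.coordChange a.1 x y)) j) := by
      have hsub : b.baseSet ∩ ((splitCore V).localTriv c).baseSet ∩ W ⊆ a.1.baseSet :=
        fun z hz => mem_iInter₂.1 (hWS hz.2) a ha
      refine IsSmoothWeightedFun.smul (ρ a).contMDiff.contMDiffOn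
        (IsSmoothWeightedFun.linear (fun v => (hT a c i v).mono fun z hz => ⟨hsub hz, hz.1.2⟩)
          (fun l => ?_) j)
      exact isWeightedPolynomial_iff.1 ((F.isFiltered b hb a.1 a.2).mono fun z hz =>
        ⟨hz.1.1, hsub hz⟩) ⟨i, l⟩
    refine (IsSmoothWeightedFun.sum h1).congr fun z hz y => ?_
    refine (congrFun (hf ⟨b, hb⟩ c i hz.1 y S fun a ha => ?_) j).trans ?_
    · exact Finset.mem_coe.1 (hρS z hz.2 ((ρ.mem_finsupport z).1 ha))
    · exact Finset.sum_apply j S _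
  refine hfil.nonempty_iso ?_
  rintro b hb _ ⟨c, rfl⟩
  refine (hfil.2 b hb _ ⟨c, rfl⟩).exists_inverse (T ⟨b, hb⟩ c) (hT ⟨b, hb⟩ c) ?_ ?_
  · intro i x hx
    have h1 : Bijective ((τ c i).linearMapAt ℝ x) := by
      rw [(τ c i).linearMapAt_def_of_mem (mem_iInter.1 hx.2 i)]
      exact ((τ c i).linearEquivAt ℝ x (mem_iInter.1 hx.2 i)).bijective
    exact h1.comp (θ.bijective ⟨b, hb⟩ i x hx.1)
  · intro i x hx y z hyz
    -- Passing from `b` to `a` changes the difference by `gradedCoordChange`, which `compat`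
    -- absorbs. Every chart thus contributes the same linear map `T ⟨b, hb⟩ c i`, and the weights
    -- sum to one.
    have h1 (a : F.atlas) (ha : a ∈ ρ.finsupport x) :
        ρ a x • T a c i x (block i (b.coordChange a.1 x y)) -
          ρ a x • T a c i x (block i (b.coordChange a.1 x z)) =
        ρ a x • T ⟨b, hb⟩ c i x (block i y - block i z) := by
      have hxa : x ∈ a.1.baseSet := hρ a (subset_tsupport _ ((ρ.mem_finsupport x).1 ha))
      rw [← smul_sub, ← map_sub, F.block_coordChange_sub i (e := ⟨b, hb⟩) (e' := a) ⟨hx.1, hxa⟩ hyz]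
      simp only [T, LinearMap.comp_apply]
      rw [θ.compat ⟨b, hb⟩ a i x ⟨hx.1, hxa⟩]
    have h2 : ∑ a ∈ ρ.finsupport x, ρ a x • T a c i x (block i (b.coordChange a.1 x y)) -
        ∑ a ∈ ρ.finsupport x, ρ a x • T a c i x (block i (b.coordChange a.1 x z)) =
        T ⟨b, hb⟩ c i x (block i y - block i z) := by
      rw [← Finset.sum_sub_distrib, Finset.sum_congr rfl h1, ← Finset.sum_smul,
        ρ.sum_finsupport x (mem_univ x), one_smul]
    exact (congrArg₂ (· - ·) (hf ⟨b, hb⟩ c i hx y _ subset_rfl)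
      (hf ⟨b, hb⟩ c i hx z _ subset_rfl)).trans h2

end FilteredBundle

/-! ### The model bundles of a filterable tower -/

namespace FilteredBundle

variable {k : ℕ} {M : SmoothManifold.{u}} (F : FilteredBundle.{u} k M)

/-- The coordinates of weight `i + 1` of two points in the same fibre of `F_{i+1} → F_{i}` change
by the transition functions of the graded vector bundle. -/
theorem levelTriv_sub (i : Fin k) {e e' : F.atlas} {p q : F.truncLevel (i.val + 1)}
    (hpq : F.truncProj i.val p = F.truncProj i.val q)
    (hx : F.truncBase (i.val + 1) p ∈ e.1.baseSet ∩ e'.1.baseSet) :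
    (F.levelTriv i e' p).2 - (F.levelTriv i e' q).2 =
      F.gradedCoordChange i e e' (F.truncBase (i.val + 1) p)
        ((F.levelTriv i e p).2 - (F.levelTriv i e q).2) := by
  obtain ⟨x, a⟩ := p
  obtain ⟨z, b⟩ := q
  obtain rfl : x = z := congrArg (F.truncBase i.val) hpq
  have hab : truncateSucc i.val a = truncateSucc i.val b := by
    have h := hpq
    unfold truncProj at h
    exact eq_of_heq (TotalSpace.mk.inj h).2
  -- Points over `x` are stored in the chart `r`. The difference formula from `e` to `e'` is applied
  -- to their images under the transition from `r` to `e`.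
  let r := (F.truncCore (i.val + 1)).indexAt x
  have hr : x ∈ r.1.baseSet := (F.truncCore (i.val + 1)).mem_baseSet_at x
  have hlow : truncate i.val (extendZero (i.val + 1) a) =
      truncate i.val (extendZero (i.val + 1) b) := by
    ext s
    have := congrFun hab s
    simpa [truncate, extendZero, truncateSucc, s.2.trans i.val.le_succ] using this
  change x ∈ e.1.baseSet ∩ e'.1.baseSet at hx
  have h1 := F.block_coordChange_sub i hx (F.truncate_coordChange_congr r e ⟨hr, hx.1⟩ hlow)
  rw [r.1.coordChange_coordChange e.1 e'.1 hr hx.1, r.1.coordChange_coordChange e.1 e'.1 hr hx.1]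
    at h1
  exact h1

/-- A section of `F` induces a section of `F_{l}`. -/
theorem exists_section_truncLevel (l : ℕ) {s : M → F.total}
    (hs : ContMDiff M.I F.total.I ∞ s) (hps : ∀ x, F.proj (s x) = x) :
    ∃ t : M → F.truncLevel l, ContMDiff M.I (F.truncLevel l).I ∞ t ∧
      ∀ x, F.truncBase l (t x) = x := by
  let r (x : M) := (F.truncCore l).indexAt x
  let t (x : M) : F.truncLevel l :=
    (⟨x, truncate l ((r x).1 (s x)).2⟩ : TotalSpace _ (F.truncCore l).Fiber)
  refine ⟨t, fun x => ?_, fun x => rfl⟩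
  obtain ⟨e, he, hx⟩ := F.exists_mem_baseSet x
  have hsrc (z : M) (hz : z ∈ e.baseSet) : s z ∈ e.source :=
    e.mem_source.2 (by rw [hps]; exact hz)
  have h1 : ContMDiffOn M.I 𝓘(ℝ, LowCoord F.rank l → ℝ) ∞
      (fun z => truncate l (e (s z)).2) e.baseSet :=
    (contDiff_truncate l).contMDiff.comp_contMDiffOn (contMDiff_snd.comp_contMDiffOn
      ((F.isSmooth e he).1.comp hs.contMDiffOn hsrc))
  have h2 := (F.isSmooth_truncTriv l ⟨e, he⟩).2.comp (contMDiffOn_id.prodMk h1)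
    (fun z hz => F.mem_truncTriv_target.2 hz)
  -- The chart `r z` used to define `t` may jump with `z`. Truncation is compatible with transition
  -- functions, so in the fixed chart `e` the section is the truncation of `e (s z)`.
  refine (h2.congr fun z hz => ?_).contMDiffAt (e.open_baseSet.mem_nhds hx)
  have hr : z ∈ (r z).1.baseSet := (F.truncCore l).mem_baseSet_at z
  refine congrArg (fun a : LowCoord F.rank l → ℝ =>
    (⟨z, a⟩ : TotalSpace _ (F.truncCore l).Fiber)) ?_
  change _ = truncate l (e.coordChange (r z).1 z (extendZero l (truncate l (e (s z)).2)))
  rw [F.truncate_coordChange_congr ⟨e, he⟩ (r z) ⟨hz, hr⟩ (truncate_extendZero l _)]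
  have h3 := exists_eq_symm (F := F) (p := s z) (e := e) (by rw [hps]; exact hz)
  rw [hps] at h3
  conv_lhs => rw [h3]
  rfl

/-- The zero section has constant coordinates zero in every chart, because the transition functions
are linear. -/
theorem exists_section_split (V : Fin k → SmoothVectorBundle.{u, v} M) :
    ∃ s : M → (split V).total, ContMDiff M.I (split V).total.I ∞ s ∧
      ∀ x, (split V).proj (s x) = x := by
  refine ⟨fun x => splitMk V x 0, fun x => ?_, fun x => rfl⟩
  let t := (splitCore V).localTriv x
  have hx : x ∈ t.baseSet := (splitCore V).mem_baseSet_at x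
  have h1 := ((split V).isSmooth _ ⟨x, rfl⟩).2.comp
    (contMDiffOn_id.prodMk (contMDiffOn_const (c := (0 : Coord (split V).rank → ℝ))))
    (fun z hz => t.mem_target.2 hz)
  refine (h1.congr (f₁ := fun x => splitMk V x 0) fun z hz => ?_).contMDiffAt
    (t.open_baseSet.mem_nhds hx)
  have hz' : splitMk V z 0 ∈ t.source := t.mem_source.2 hz
  refine (t.toOpenPartialHomeomorph.left_inv hz').symm.trans ?_
  refine congrArg t.toOpenPartialHomeomorph.symm (Prod.ext rfl (funext fun s => ?_))
  have := congrFun (block_splitMk V (0 : ∀ i, (V i).fiber z) hz s.1) s.2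
  rw [Pi.zero_apply, map_zero] at this
  exact this

/-- A filtered bundle has no distinguished zero; the section is the zero section of the sum of its
graded bundles, carried over by a splitting. -/
theorem exists_section : ∃ s : M → F.total, ContMDiff M.I F.total.I ∞ s ∧
    ∀ x, F.proj (s x) = x := by
  obtain ⟨φ⟩ := F.nonempty_iso_split
    (Framing.ofIso F fun i => SmoothVectorBundle.Iso.refl (F.graded i))
  obtain ⟨s, hs, hps⟩ := exists_section_split F.graded
  exact ⟨_, φ.toDiffeomorph.symm.contMDiff.comp hs, fun x =>
    (φ.isFilteredMap_symm.1 _).trans (hps x)⟩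

end FilteredBundle

/-! ### Linear parts of tower isomorphisms and descent of the model bundles to the base -/

namespace AffineTower

variable {k : ℕ} {T : AffineTower.{u} k} {F : FilteredBundle.{u} k T.base}

/-- The normalization over `M` is imposed at level `0` only; it propagates upwards because `φ`
commutes with the projections. -/
theorem Iso.truncBase_eq {φ : T.Iso F.tower}
    (hφ : ∀ x : T.base, F.truncBase 0 (φ.toDiffeomorph 0 x) = x) (j : Fin (k + 1))
    (b : T.level j) : F.truncBase j.val (φ.toDiffeomorph j b) = T.toBase j b := by
  induction j using Fin.induction with
  | zero => exact hφ b
  | succ i ih =>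
    refine Eq.trans ?_ (ih ((T.bundle i).proj b))
    rw [← φ.comm i b]
    rfl

/-- Pulling back along such a section undoes the pull-back along `toBase`, so isomorphisms of
pulled-back bundles descend to `M`. -/
theorem IsTowerOf.exists_section (h : T.IsTowerOf F) (j : Fin (k + 1)) :
    ∃ s : T.base → T.level j, ContMDiff T.base.I (T.level j).I ∞ s ∧ ∀ x, T.toBase j (s x) = x := by
  obtain ⟨φ, hφ⟩ := h
  obtain ⟨s, hs, hps⟩ := F.exists_section
  obtain ⟨t, ht, hpt⟩ := F.exists_section_truncLevel j.val hs hps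
  refine ⟨fun x => (φ.toDiffeomorph j).symm (t x),
    (φ.toDiffeomorph j).symm.contMDiff.comp ht, fun x => ?_⟩
  rw [← Iso.truncBase_eq hφ]
  exact (congrArg (F.truncBase j.val) ((φ.toDiffeomorph j).apply_symm_apply (t x))).trans (hpt x)

/-- The local expression of an isomorphism between an affine tower and the tower of a filtered
bundle. -/
def Iso.localRep (φ : T.Iso F.tower) (i : Fin k) (a : (T.bundle i).atlas) (e : F.atlas)
    (b : T.level i.castSucc) (y : Fin (T.bundle i).rank → ℝ) : Fin (F.rank i) → ℝ :=
  (F.levelTriv i e (φ.toDiffeomorph i.succ (a.1.toOpenPartialHomeomorph.symm (b, y)))).2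

variable {φ : T.Iso F.tower}

theorem Iso.truncProj_apply_symm (i : Fin k) (a : (T.bundle i).atlas) {b : T.level i.castSucc}
    (hb : b ∈ a.1.baseSet) (y : Fin (T.bundle i).rank → ℝ) :
    F.truncProj i.val (φ.toDiffeomorph i.succ (a.1.toOpenPartialHomeomorph.symm (b, y))) =
      φ.toDiffeomorph i.castSucc b := by
  refine (φ.comm i _).trans ?_
  rw [a.1.proj_symm_apply' hb]

theorem Iso.localRep_coordChange_left (i : Fin k) {a a' : (T.bundle i).atlas} (e : F.atlas)
    {b : T.level i.castSucc} (hb : b ∈ a.1.baseSet ∩ a'.1.baseSet)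
    (y : Fin (T.bundle i).rank → ℝ) :
    φ.localRep i a' e b (a.1.coordChange a'.1 b y) = φ.localRep i a e b y := by
  have h1 : a.1.toOpenPartialHomeomorph.symm (b, y) ∈ a'.1.source :=
    a'.1.mem_source.2 (by rw [a.1.proj_symm_apply' hb.1]; exact hb.2)
  have h2 : a'.1.toOpenPartialHomeomorph.symm (b, a.1.coordChange a'.1 b y) =
      a.1.toOpenPartialHomeomorph.symm (b, y) := by
    conv_rhs => rw [← a'.1.toOpenPartialHomeomorph.left_inv h1]
    congr 1
    refine Prod.ext ?_ rfl
    exact ((a'.1.coe_fst h1).trans (a.1.proj_symm_apply' hb.1)).symm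
  unfold Iso.localRep
  rw [h2]

/-- `φ` sends the fibre over `b` into one fibre of `F_{i+1} → F_{i}`, where differences change by
the graded cocycle. Only the image of `b` in the base enters, so the target bundle is a pull-back
from the base. -/
theorem Iso.localRep_coordChange_right (hφ : ∀ x : T.base, F.truncBase 0 (φ.toDiffeomorph 0 x) = x)
    (i : Fin k) (a : (T.bundle i).atlas) {e e' : F.atlas} {b : T.level i.castSucc}
    (hb : b ∈ a.1.baseSet) (he : T.toBase i.castSucc b ∈ e.1.baseSet ∩ e'.1.baseSet)
    (y z : Fin (T.bundle i).rank → ℝ) :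
    φ.localRep i a e' b y - φ.localRep i a e' b z =
      F.gradedCoordChange i e e' (T.toBase i.castSucc b)
        (φ.localRep i a e b y - φ.localRep i a e b z) := by
  have h1 : F.truncBase (i.val + 1)
      (φ.toDiffeomorph i.succ (a.1.toOpenPartialHomeomorph.symm (b, y))) =
        T.toBase i.castSucc b :=
    (congrArg (F.truncBase i.val) (φ.truncProj_apply_symm i a hb y)).trans
      (Iso.truncBase_eq hφ i.castSucc b)
  have h2 := F.levelTriv_sub i (e := e) (e' := e')
    ((φ.truncProj_apply_symm i a hb y).trans (φ.truncProj_apply_symm i a hb z).symm)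
    (by rw [h1]; exact he)
  rw [h1] at h2
  exact h2

/-- A diffeomorphism of one level covering a diffeomorphism of the level below restricts to
bijections of the fibres. -/
theorem Iso.bijective_localRep (hφ : ∀ x : T.base, F.truncBase 0 (φ.toDiffeomorph 0 x) = x)
    (i : Fin k) (a : (T.bundle i).atlas) {e : F.atlas} {b : T.level i.castSucc}
    (hb : b ∈ a.1.baseSet) (he : T.toBase i.castSucc b ∈ e.1.baseSet) :
    Bijective (φ.localRep i a e b) := by
  have hs (y : Fin (T.bundle i).rank → ℝ) :
      φ.toDiffeomorph i.succ (a.1.toOpenPartialHomeomorph.symm (b, y)) ∈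
        (F.levelTriv i e).source := by
    refine (F.levelTriv i e).mem_source.2 ?_
    rw [φ.truncProj_apply_symm i a hb]
    change F.truncBase i.val _ ∈ e.1.baseSet
    rw [← Iso.truncBase_eq hφ] at he
    exact he
  have hfst (y : Fin (T.bundle i).rank → ℝ) := ((F.levelTriv i e).coe_fst (hs y)).trans
    (φ.truncProj_apply_symm i a hb y)
  constructor
  · intro y z hyz
    have h1 := (F.levelTriv i e).injOn (hs y) (hs z)
      (Prod.ext ((hfst y).trans (hfst z).symm) hyz)
    have h2 := (φ.toDiffeomorph i.succ).injective h1
    have h3 := congrArg (fun p => (a.1 p).2) h2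
    simpa only [a.1.apply_symm_apply' hb] using h3
  · intro z
    have hq : (φ.toDiffeomorph i.castSucc b, z) ∈ (F.levelTriv i e).target := by
      refine (F.levelTriv i e).mem_target.2 ?_
      rw [← Iso.truncBase_eq hφ] at he
      exact he
    let q : F.truncLevel (i.val + 1) := (F.levelTriv i e).toOpenPartialHomeomorph.symm
      (φ.toDiffeomorph i.castSucc b, z)
    let p : T.level i.succ := (φ.toDiffeomorph i.succ).symm q
    have hpq : φ.toDiffeomorph i.succ p = q := (φ.toDiffeomorph i.succ).apply_symm_apply q
    have hp : (T.bundle i).proj p = b := by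
      refine (φ.toDiffeomorph i.castSucc).injective ?_
      refine (φ.comm i p).symm.trans ?_
      rw [hpq]
      exact (F.levelTriv i e).proj_symm_apply hq
    have hpa : p ∈ a.1.source := a.1.mem_source.2 (by rw [hp]; exact hb)
    refine ⟨(a.1 p).2, ?_⟩
    have h1 : a.1.toOpenPartialHomeomorph.symm (b, (a.1 p).2) = p := by
      conv_rhs => rw [← a.1.toOpenPartialHomeomorph.left_inv hpa]
      congr 1
      exact Prod.ext (hp.symm.trans (a.1.coe_fst hpa).symm) rfl
    unfold Iso.localRep
    rw [h1, hpq]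
    exact congrArg Prod.snd ((F.levelTriv i e).apply_symm_apply hq)

theorem Iso.contMDiffOn_localRep (hφ : ∀ x : T.base, F.truncBase 0 (φ.toDiffeomorph 0 x) = x)
    (i : Fin k) (a : (T.bundle i).atlas) (e : F.atlas) (y : Fin (T.bundle i).rank → ℝ) :
    ContMDiffOn (T.level i.castSucc).I 𝓘(ℝ, Fin (F.rank i) → ℝ) ∞
      (fun b => φ.localRep i a e b y) (a.1.baseSet ∩ T.toBase i.castSucc ⁻¹' e.1.baseSet) := by
  have h1 := (((T.bundle i).isSmooth a.1 a.2).2.comp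
    (contMDiffOn_id.prodMk (contMDiffOn_const (c := y)))
    (fun b (hb : b ∈ a.1.baseSet) => a.1.mem_target.2 hb)).mono
      (t := a.1.baseSet ∩ T.toBase i.castSucc ⁻¹' e.1.baseSet) inter_subset_left
  have h2 := (φ.toDiffeomorph i.succ).contMDiff.comp_contMDiffOn h1
  refine contMDiff_snd.comp_contMDiffOn ((F.isSmooth_levelTriv i e).1.comp h2 fun b hb => ?_)
  refine (F.levelTriv i e).mem_source.2 ?_
  have h3 : F.truncBase i.val (φ.toDiffeomorph i.castSucc b) ∈ e.1.baseSet := by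
    have := hb.2
    rw [mem_preimage, ← Iso.truncBase_eq hφ] at this
    exact this
  exact (φ.truncProj_apply_symm i a hb.1 y).symm ▸ h3

/-- The linear part of the local expression of an isomorphism with the tower of a filtered
bundle. -/
theorem Iso.exists_linear_localRep
    (hφ : ∀ x : T.base, F.truncBase 0 (φ.toDiffeomorph 0 x) = x) (i : Fin k) :
    ∃ L : (T.bundle i).atlas → F.atlas → T.level i.castSucc →
        (Fin (T.bundle i).rank → ℝ) →ₗ[ℝ] (Fin (F.rank i) → ℝ),
      ∀ a e, ∀ b ∈ a.1.baseSet, T.toBase i.castSucc b ∈ e.1.baseSet →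
        (∀ y z, φ.localRep i a e b y - φ.localRep i a e b z = L a e b (y - z)) ∧
        Bijective (L a e b) := by
  have h (a : (T.bundle i).atlas) (e : F.atlas) (b : T.level i.castSucc) :
      ∃ L : (Fin (T.bundle i).rank → ℝ) →ₗ[ℝ] (Fin (F.rank i) → ℝ),
        b ∈ a.1.baseSet → T.toBase i.castSucc b ∈ e.1.baseSet →
        (∀ y z, φ.localRep i a e b y - φ.localRep i a e b z = L (y - z)) ∧ Bijective L := by
    by_cases hb : b ∈ a.1.baseSet ∧ T.toBase i.castSucc b ∈ e.1.baseSet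
    · obtain ⟨g, hg⟩ := φ.isAffine i a.1 a.2 (F.levelTriv i e) ⟨e, rfl⟩ b hb.1 (by
        have := hb.2
        rw [← Iso.truncBase_eq hφ] at this
        exact this)
      have hg' : φ.localRep i a e b = g := funext hg
      refine ⟨g.linear, fun _ _ => ⟨fun y z => ?_, ?_⟩⟩
      · rw [hg']
        exact (g.linearMap_vsub y z).symm
      · have hbij := Iso.bijective_localRep hφ i a hb.1 hb.2
        rw [hg'] at hbij
        exact g.linear_bijective_iff.2 hbij
    -- Outside the charts the default value zero makes `L` a family defined on the whole level.
    · exact ⟨0, fun h1 h2 => absurd ⟨h1, h2⟩ hb⟩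
  choose L hL using h
  exact ⟨L, hL⟩

/-- The model bundles of the tower of a filtered bundle are pull-backs of its graded bundles. -/
theorem IsTowerOf.isModeledOn_graded (h : T.IsTowerOf F) : T.IsModeledOn F.graded := by
  obtain ⟨φ, hφ⟩ := h
  intro i
  obtain ⟨L, hL⟩ := Iso.exists_linear_localRep hφ i
  -- `hleft` and `hright` say that `L` is compatible with the cocycle of the model bundle on one
  -- side and with the pulled-back graded cocycle on the other, so the local linear parts glue.
  have hleft (a a' : (T.bundle i).atlas) (e : F.atlas) (b : T.level i.castSucc)
      (hb : b ∈ a.1.baseSet ∩ a'.1.baseSet) (he : T.toBase i.castSucc b ∈ e.1.baseSet)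
      (v : Fin (T.bundle i).rank → ℝ) :
      L a' e b ((T.bundle i).modelCore.coordChange a a' b v) = L a e b v := by
    obtain ⟨g, hg⟩ := (T.bundle i).isAffine a a.2 a' a'.2 b hb
    have h1 : (T.bundle i).modelCore.coordChange a a' b v =
        a.1.coordChange a'.1 b v - a.1.coordChange a'.1 b 0 := by
      refine (AffineBundle.linearPart_eq g hg v).trans ?_
      rw [hg, hg, ← vsub_eq_sub, ← g.linearMap_vsub, vsub_eq_sub, sub_zero]
    rw [h1, ← ((hL a' e b hb.2 he).1 _ _), φ.localRep_coordChange_left i e hb,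
      φ.localRep_coordChange_left i e hb, (hL a e b hb.1 he).1, sub_zero]
  have hright (a : (T.bundle i).atlas) (e e' : F.atlas) (b : T.level i.castSucc)
      (hb : b ∈ a.1.baseSet) (he : T.toBase i.castSucc b ∈ e.1.baseSet ∩ e'.1.baseSet)
      (v : Fin (T.bundle i).rank → ℝ) :
      L a e' b v = F.gradedCoordChange i e e' (T.toBase i.castSucc b) (L a e b v) := by
    have h1 := Iso.localRep_coordChange_right hφ i a hb he v 0
    rw [(hL a e' b hb he.2).1, (hL a e b hb he.1).1, sub_zero] at h1
    exact h1
  let A (b : T.level i.castSucc) := (T.bundle i).modelCore.indexAt b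
  let C (x : T.base) := (F.gradedCore i).indexAt x
  have hA (b : T.level i.castSucc) : b ∈ (A b).1.baseSet := (T.bundle i).modelCore.mem_baseSet_at b
  have hC (x : T.base) : x ∈ (C x).1.baseSet := (F.gradedCore i).mem_baseSet_at x
  let ψ (b : T.level i.castSucc) : (T.bundle i).model.fiber b ≃ₗ[ℝ]
      ((F.graded i).pullback (T.toBase i.castSucc)).fiber b :=
    LinearEquiv.ofBijective (L (A b) (C (T.toBase i.castSucc b)) b)
      (hL _ _ b (hA b) (hC _)).2
  refine ⟨SmoothVectorBundle.Iso.ofContMDiff ψ ?_⟩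
  refine SmoothVectorBundle.contMDiff_of_local
    (fun b => ((ψ b : _ ≃ₗ[ℝ] _) : (T.bundle i).model.fiber b →ₗ[ℝ]
      ((F.graded i).pullback (T.toBase i.castSucc)).fiber b)) fun b₀ => ?_
  let a := A b₀
  let c := C (T.toBase i.castSucc b₀)
  let t : Trivialization (Fin (T.bundle i).model.rank → ℝ)
    (TotalSpace.proj : (T.bundle i).model.Total → T.level i.castSucc) :=
    (T.bundle i).modelCore.localTriv a
  let t₁ : Trivialization (Fin (F.graded i).rank → ℝ)
    (TotalSpace.proj : (F.graded i).Total → T.base) := (F.gradedCore i).localTriv c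
  have ht₁ : MemTrivializationAtlas t₁ := ⟨⟨c, rfl⟩⟩
  let t' : Trivialization (Fin ((F.graded i).pullback (T.toBase i.castSucc)).rank → ℝ)
    (TotalSpace.proj : ((F.graded i).pullback (T.toBase i.castSucc)).Total →
      T.level i.castSucc) := t₁.pullback (T.toBase i.castSucc)
  refine ⟨t, t', ⟨⟨a, rfl⟩⟩, ⟨⟨t₁, ht₁, rfl⟩⟩, ⟨hA b₀, hC _⟩, L a c, fun v => ?_,
    fun b hb v => ?_⟩
  -- The linear part at `v` is the difference of the values at `v` and `0`, hence smooth in `b`.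
  · have h1 := (Iso.contMDiffOn_localRep hφ i a c v).sub (Iso.contMDiffOn_localRep hφ i a c 0)
    refine h1.congr fun b hb => ?_
    exact ((congrArg (L a c b) (sub_zero v)).symm.trans ((hL a c b hb.1 hb.2).1 v 0).symm)
  -- At `b` the map is read in the charts attached to `b`; compatibility replaces them by the fixed
  -- charts `a` and `c`.
  · refine (hright (A b) (C _) c b (hA b) ⟨hC _, hb.2⟩ v).symm.trans ?_
    exact (hleft (A b) a c b ⟨hA b, hb.1⟩ hb.2 v).symm

/-- Vector bundles on which a filterable tower is modeled are unique up to isomorphism. -/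
theorem IsTowerOf.nonempty_iso_of_isModeledOn (h : T.IsTowerOf F)
    {V : Fin k → SmoothVectorBundle.{u, v} T.base} {W : Fin k → SmoothVectorBundle.{u, w} T.base}
    (hV : T.IsModeledOn V) (hW : T.IsModeledOn W) (i : Fin k) : Nonempty ((V i).Iso (W i)) := by
  obtain ⟨α⟩ := hV i
  obtain ⟨β⟩ := hW i
  obtain ⟨s, hs, hps⟩ := h.exists_section i.castSucc
  exact (α.symm.trans β).descend hs hps

/-- The tower is also modeled on the graded bundles of `F`. Uniqueness of such bundles identifies
them with `V`, which supplies a framing. -/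
theorem IsTowerOf.nonempty_iso_split (h : T.IsTowerOf F)
    {V : Fin k → SmoothVectorBundle.{u, v} T.base} (hV : T.IsModeledOn V) :
    Nonempty (F.Iso (FilteredBundle.split V)) :=
  F.nonempty_iso_split (FilteredBundle.Framing.ofIso F fun i =>
    (h.nonempty_iso_of_isModeledOn h.isModeledOn_graded hV i).some)

end AffineTower

end

theorem theoremT2 {k : ℕ} (T : AffineTower.{u} k) (hT : T.IsFilterable) :
    (∀ F F' : FilteredBundle.{u} k T.base, T.IsTowerOf F → T.IsTowerOf F' →
      Nonempty (F.Iso F')) ∧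
    (∃ V : Fin k → SmoothVectorBundle.{u, 0} T.base, T.IsModeledOn V) ∧
    (∀ V : Fin k → SmoothVectorBundle.{u, v} T.base, T.IsModeledOn V →
      ∀ F : FilteredBundle.{u} k T.base, T.IsTowerOf F →
        Nonempty (F.Iso (FilteredBundle.split V))) ∧
    (∀ (V : Fin k → SmoothVectorBundle.{u, v} T.base)
      (W : Fin k → SmoothVectorBundle.{u, w} T.base), T.IsModeledOn V → T.IsModeledOn W →
        ∀ i, Nonempty ((V i).Iso (W i))) := by
  obtain ⟨F₀, hF₀⟩ := hT
  refine ⟨fun F F' hF hF' => ?_, ⟨_, hF₀.isModeledOn_graded⟩,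
    fun V hV F hF => hF.nonempty_iso_split hV,
    fun V W hV hW i => hF₀.nonempty_iso_of_isModeledOn hV hW i⟩
  -- The graded bundles of `F₀` serve as a common splitting for `F` and `F'`.
  obtain ⟨α⟩ := hF.nonempty_iso_split hF₀.isModeledOn_graded
  obtain ⟨β⟩ := hF'.nonempty_iso_split hF₀.isModeledOn_graded
  exact ⟨α.trans β.symm⟩
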